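/- Let $M$ be a compact connected smooth manifold (without boundary) of dimension $n$, and let $(g,A)$ be a statistical structure on $M$, that is, $g$ is a smooth Riemannian metric and $A$ is a smooth symmetric $(0,3)$-tensor field. Let $\hat\nabla$ be the Levi-Civita connection of $g$, let $K$ be the $(1,2)$-tensor field determined by $g(K(X,Y),Z)=A(X,Y,Z)$, let $\nabla=\hat\nabla+K$, and let $R$ be the curvature tensor of $\nabla$. Let $\tau$ be the $1$-form $\tau(X)=\operatorname{tr}_g A(X,\cdot,\cdot)$. Assume that $(g,A)$ is conjugate symmetric, that is, $g(R(X,Y)Z,W)=-g(R(X,Y)W,Z)$ for all $X,Y,Z,W$. If the sectional curvature $\hat k$ of $g$ is nonnegative on all planes tangent to $M$ and $\hat\nabla^2\tau=\hat\nabla(\hat\nabla\tau)=0$ on $M$, then $\hat\nabla A=0$ on $M$. If, moreover, $n\ge 2$ and there is a point $p\in M$ such that $\hat k>0$ on all planes in $T_pM$, then the structure is trivial: $K=0$ on $M$. -/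

import Mathlib

open scoped Manifold ContDiff Bundle

noncomputable section

namespace Statistical

/-! ### Tensor calculus on an open subset of a vector space

Tensor fields are given by their values on constant vector fields; a connection is given by its
coefficients `Γ y u v`, the value at `y` of the covariant derivative of the constant vector field
`v` in the direction `u`. -/

section Local

variable {E : Type*} [NormedAddCommGroup E] [NormedSpace ℝ E]

/-- The coefficients of the Levi-Civita connection of a metric `g`: the vector `Γ y u v` with
`2 g(Γ y u v, w) = (∂_u g)(v, w) + (∂_v g)(u, w) - (∂_w g)(u, v)` for all `w`.
The map `(g y).inverse` is the inverse of `g y : E → E*`, which exists where `g y` is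
positive definite (and `E` has finite dimension). -/
def christoffel (g : E → E →L[ℝ] E →L[ℝ] ℝ) (y u v : E) : E :=
  (g y).inverse ((1 / 2 : ℝ) •
    (fderiv ℝ g y u v + fderiv ℝ g y v u - ((fderiv ℝ g y).flip u).flip v))

/-- The covariant derivative of a covariant tensor field `T` of degree `k`, a tensor field of
degree `k + 1`: `(∇T)(v₀, v₁, …, vₖ) = (∇_{v₀} T)(v₁, …, vₖ)`. -/
def covDeriv (Γ : E → E → E → E) {k : ℕ} (T : E → (Fin k → E) → ℝ) (y : E)
    (v : Fin (k + 1) → E) : ℝ :=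
  fderiv ℝ (fun z => T z (Fin.tail v)) y (v 0) -
    ∑ i, T y (Function.update (Fin.tail v) i (Γ y (v 0) (Fin.tail v i)))

/-- The curvature tensor `R(u, v) w = ∇_u ∇_v w - ∇_v ∇_u w` (on constant vector fields, whose
brackets vanish) of the connection with coefficients `Γ`. -/
def curvature (Γ : E → E → E → E) (y u v w : E) : E :=
  fderiv ℝ (fun z => Γ z v w) y u - fderiv ℝ (fun z => Γ z u w) y v
    + Γ y u (Γ y v w) - Γ y v (Γ y u w)

end Local

/-! ### Statistical structures -/

section Manifold

variable {n : ℕ} {M : Type*} [TopologicalSpace M] [ChartedSpace (EuclideanSpace ℝ (Fin n)) M]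

/-- The differential at `y` of the inverse `e.symm` of a chart `e`: it sends a vector of the model
space to the tangent vector that has it as its coordinates in the chart `e`. -/
def chartVec (e : OpenPartialHomeomorph M (EuclideanSpace ℝ (Fin n)))
    (y : EuclideanSpace ℝ (Fin n)) :
    EuclideanSpace ℝ (Fin n) →L[ℝ] TangentSpace (𝓡 n) (e.symm y) :=
  mfderiv (𝓡 n) (𝓡 n) e.symm y

/-- The expression in a chart `e` of a covariant tensor field of degree `k` on `M`. -/
def inChart (e : OpenPartialHomeomorph M (EuclideanSpace ℝ (Fin n))) {k : ℕ}
    (T : ∀ x : M, (Fin k → TangentSpace (𝓡 n) x) → ℝ)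
    (y : EuclideanSpace ℝ (Fin n)) (v : Fin k → EuclideanSpace ℝ (Fin n)) : ℝ :=
  T (e.symm y) (fun i => chartVec e y (v i))

/-- A statistical structure `(g, A)` on an `n`-dimensional smooth manifold: a smooth Riemannian
metric `g` and a smooth symmetric cubic form `A`. Smoothness of `A` means that its components in
the charts are smooth functions. -/
structure StatisticalStructure (n : ℕ) (M : Type*) [TopologicalSpace M]
    [ChartedSpace (EuclideanSpace ℝ (Fin n)) M] [IsManifold (𝓡 n) ∞ M] where
  /-- the Riemannian metric `g` -/
  metric : Bundle.ContMDiffRiemannianMetric (𝓡 n) ∞ (EuclideanSpace ℝ (Fin n))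
    (fun x : M => TangentSpace (𝓡 n) x)
  /-- the cubic form `A` -/
  cubic : ∀ x : M, TangentSpace (𝓡 n) x →L[ℝ] TangentSpace (𝓡 n) x →L[ℝ]
    TangentSpace (𝓡 n) x →L[ℝ] ℝ
  contDiffOn_cubic : ∀ e ∈ atlas (EuclideanSpace ℝ (Fin n)) M,
    ∀ v : Fin 3 → EuclideanSpace ℝ (Fin n),
      ContDiffOn ℝ ∞ (fun y => inChart e (fun x w => cubic x (w 0) (w 1) (w 2)) y v) e.target
  cubic_swap_left : ∀ (x : M) (u v w : TangentSpace (𝓡 n) x), cubic x u v w = cubic x v u w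
  cubic_swap_right : ∀ (x : M) (u v w : TangentSpace (𝓡 n) x), cubic x u v w = cubic x u w v

namespace StatisticalStructure

variable [IsManifold (𝓡 n) ∞ M] (S : StatisticalStructure n M)

/-- The difference tensor `K = A^♯`: `K x u v` is the vector with `g(K x u v, w) = A(u, v, w)`. -/
def K (x : M) (u : TangentSpace (𝓡 n) x) : TangentSpace (𝓡 n) x →L[ℝ] TangentSpace (𝓡 n) x :=
  (S.metric.inner x).inverse ∘L S.cubic x u

/-- The structure is trivial if `K` vanishes identically. -/
def IsTrivial : Prop := ∀ (x : M) (u v : TangentSpace (𝓡 n) x), S.K x u v = 0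

/-- The cubic form `A` as a covariant tensor field of degree `3`. -/
def A (x : M) (v : Fin 3 → TangentSpace (𝓡 n) x) : ℝ := S.cubic x (v 0) (v 1) (v 2)

/-- The Czebyshev form `τ(X) = tr_g A(X, ·, ·) = tr K_X`, a covariant tensor field of degree
`1`. -/
def τ (x : M) (v : Fin 1 → TangentSpace (𝓡 n) x) : ℝ :=
  LinearMap.trace ℝ (TangentSpace (𝓡 n) x) (S.K x (v 0))

/-! In the rest of the section `e` is a chart of `M`. All the objects below are the coordinate
expressions, at points of the target of `e`, of the corresponding objects of `M`. -/

variable (e : OpenPartialHomeomorph M (EuclideanSpace ℝ (Fin n)))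

/-- The metric in the chart `e`. -/
def gLoc (y : EuclideanSpace ℝ (Fin n)) :
    EuclideanSpace ℝ (Fin n) →L[ℝ] EuclideanSpace ℝ (Fin n) →L[ℝ] ℝ :=
  (chartVec e y).precomp ℝ ∘L S.metric.inner (e.symm y) ∘L chartVec e y

/-- The difference tensor `K` in the chart `e`. -/
def KLoc (y u v : EuclideanSpace ℝ (Fin n)) : EuclideanSpace ℝ (Fin n) :=
  (chartVec e y).inverse (S.K (e.symm y) (chartVec e y u) (chartVec e y v))

/-- The coefficients of the Levi-Civita connection `∇̂` of `g` in the chart `e`. -/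
def ΓHat (y u v : EuclideanSpace ℝ (Fin n)) : EuclideanSpace ℝ (Fin n) :=
  christoffel (S.gLoc e) y u v

/-- The coefficients of the statistical connection `∇ = ∇̂ + K` in the chart `e`. -/
def Γ (y u v : EuclideanSpace ℝ (Fin n)) : EuclideanSpace ℝ (Fin n) :=
  S.ΓHat e y u v + S.KLoc e y u v

/-- The structure is conjugate symmetric: the curvature tensor `R` of `∇` satisfies
`g(R(X, Y) Z, W) = - g(R(X, Y) W, Z)`. -/
def IsConjugateSymmetric : Prop :=
  ∀ e ∈ atlas (EuclideanSpace ℝ (Fin n)) M, ∀ y ∈ e.target, ∀ u v w z,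
    S.gLoc e y (curvature (S.Γ e) y u v w) z = - S.gLoc e y (curvature (S.Γ e) y u v z) w

/-- A pair of vectors (in the chart `e`) that is orthonormal at `y`. -/
def IsOrthonormalPair (y u v : EuclideanSpace ℝ (Fin n)) : Prop :=
  S.gLoc e y u u = 1 ∧ S.gLoc e y v v = 1 ∧ S.gLoc e y u v = 0

/-- The number `g(R̂(u, v) v, u)`, where `R̂` is the curvature tensor of `∇̂`: the sectional
curvature of `g` on the plane spanned by an orthonormal pair `u, v`. -/
def secHat (y u v : EuclideanSpace ℝ (Fin n)) : ℝ :=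
  S.gLoc e y (curvature (S.ΓHat e) y u v v) u

/-- The sectional curvature of `g` is nonnegative on all planes at all points of `M`. -/
def SecHatNonneg : Prop :=
  ∀ e ∈ atlas (EuclideanSpace ℝ (Fin n)) M, ∀ y ∈ e.target, ∀ u v,
    S.IsOrthonormalPair e y u v → 0 ≤ S.secHat e y u v

/-- The sectional curvature of `g` is positive on all planes at the point `p`. -/
def SecHatPosAt (p : M) : Prop :=
  ∀ e ∈ atlas (EuclideanSpace ℝ (Fin n)) M, p ∈ e.source → ∀ u v,
    S.IsOrthonormalPair e (e p) u v → 0 < S.secHat e (e p) u v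

/-- `∇̂A = 0` on `M`. -/
def NablaHatAVanishes : Prop :=
  ∀ e ∈ atlas (EuclideanSpace ℝ (Fin n)) M, ∀ y ∈ e.target, ∀ v : Fin 4 → _,
    covDeriv (S.ΓHat e) (inChart e S.A) y v = 0

/-- `∇̂²τ = ∇̂(∇̂τ) = 0` on `M`. -/
def NablaHatSqTauVanishes : Prop :=
  ∀ e ∈ atlas (EuclideanSpace ℝ (Fin n)) M, ∀ y ∈ e.target, ∀ v : Fin 3 → _,
    covDeriv (S.ΓHat e) (covDeriv (S.ΓHat e) (inChart e S.τ)) y v = 0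

end StatisticalStructure

end Manifold

end Statistical

end

/-! The proof is Bochner's technique applied to `φ = |A|²`. Conjugate symmetry makes `∇̂A` totally
symmetric (`IsCubicOn.nabla_swap`): the curvature of `∇̂ + K` is `R̂` plus a commutator of `K`, both
skew in the last two arguments, plus an alternation of `∇̂A`, which is symmetric in them and so must
vanish. In the rough Laplacian of `A` a direction of differentiation may then be exchanged with an
argument, and the Ricci identity leaves a component of `∇̂²τ = 0` and curvature terms. Hence `Δφ =
2|∇̂A|² + 2Q`, where `Q = ⟨Δ̂A, A⟩` is linear in `R̂` and quadratic in `A`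
(`IsBochnerDatum.laplacian`).

The sign of `Q` comes from an average. For a standard Gaussian vector `ξ`, with `η` the vector dual
to `A(ξ, ξ, ·)`, one has `2Q = E[g(R̂(η, ξ)ξ, η)]` (`BochnerArrays.two_mul_sum_eq_expect`). Of the
fifteen Wick pairings, eight vanish by skew-symmetry of `R̂`, one vanishes because `∇̂²τ = 0` forces
`R̂` to annihilate `τ`, and the other six add up to `2Q`. Only moments up to order six matter, so a
finitely supported distribution replaces the Gaussian and all expectations are finite sums.

Nonnegative curvature therefore gives `Δφ ≥ 0`. On a compact connected manifold Hopf's strong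
maximum principle (`eventually_eq_of_isLocalMax_of_subsolution`) makes `φ` constant, so `∇̂A = 0`
and `Q = 0`. Where the curvature is positive, `Q = 0` makes `A(ξ, ξ, ·)` proportional to `ξ` for
every `ξ` in the support; the vectors `e_a` and `e_a ± e_b` suffice to conclude `A = 0` at that
point (`BochnerArrays.eq_zero_of_sum_eq_zero`). Constancy of `φ` then gives `A = 0` everywhere. -/

namespace Statistical

/-! ### A discrete random vector with Gaussian moments up to order six -/

section Moments

variable {ι : Type*} [Fintype ι] [DecidableEq ι]

/-- The weights at the nodes `-3, …, 3` of a probability distribution with the moments of a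
standard Gaussian up to order seven. -/
noncomputable def nodeWeight (k : Fin 7) : ℝ := (![1, 9, 45, 70, 45, 9, 1] k : ℝ) / 180

/-- The nodes `-3, …, 3`. -/
def node (k : Fin 7) : ℝ := (k : ℝ) - 3

lemma nodeWeight_pos (k : Fin 7) : 0 < nodeWeight k := by
  fin_cases k <;> norm_num [nodeWeight]

lemma sum_nodeWeight : ∑ k, nodeWeight k = 1 := by
  norm_num [nodeWeight, Fin.sum_univ_succ]

lemma sum_nodeWeight_mul (f : ℝ → ℝ) : ∑ k, nodeWeight k * f (node k) =
    (f (-3) + 9 * f (-2) + 45 * f (-1) + 70 * f 0 + 45 * f 1 + 9 * f 2 + f 3) / 180 := by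
  have h : ∀ k : Fin 7, node k = ![-3, -2, -1, 0, 1, 2, 3] k := by
    intro k; fin_cases k <;> norm_num [node]
  simp only [h, nodeWeight, Fin.sum_univ_seven]
  simp
  ring

/-- The expectation of a function of independent coordinates distributed according to
`nodeWeight`. -/
noncomputable def expect (F : (ι → ℝ) → ℝ) : ℝ :=
  ∑ ε : ι → Fin 7, (∏ i, nodeWeight (ε i)) * F (fun i => node (ε i))

lemma expect_add (F G : (ι → ℝ) → ℝ) :
    expect (fun ξ => F ξ + G ξ) = expect F + expect G := by
  simp [expect, mul_add, Finset.sum_add_distrib]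

lemma expect_const_mul (c : ℝ) (F : (ι → ℝ) → ℝ) :
    expect (fun ξ => c * F ξ) = c * expect F := by
  simp only [expect, Finset.mul_sum]
  exact Finset.sum_congr rfl fun _ _ => by ring

lemma expect_sum {κ : Type*} (s : Finset κ) (F : κ → (ι → ℝ) → ℝ) :
    expect (fun ξ => ∑ k ∈ s, F k ξ) = ∑ k ∈ s, expect (F k) := by
  simp only [expect, Finset.mul_sum]
  exact Finset.sum_comm

lemma expect_nonneg {F : (ι → ℝ) → ℝ} (h : ∀ ξ, 0 ≤ F ξ) : 0 ≤ expect F :=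
  Finset.sum_nonneg fun _ _ => mul_nonneg
    (Finset.prod_nonneg fun _ _ => (nodeWeight_pos _).le) (h _)

lemma eq_zero_of_expect_eq_zero {F : (ι → ℝ) → ℝ} (h : ∀ ξ, 0 ≤ F ξ) (h0 : expect F = 0)
    (ε : ι → Fin 7) : F (fun i => node (ε i)) = 0 := by
  have hw : ∀ ε : ι → Fin 7, 0 < ∏ i, nodeWeight (ε i) := fun ε =>
    Finset.prod_pos fun _ _ => nodeWeight_pos _
  have := (Finset.sum_eq_zero_iff_of_nonneg fun ε _ => mul_nonneg (hw ε).le (h _)).1 h0 ε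
    (Finset.mem_univ _)
  exact (mul_eq_zero.1 this).resolve_left (hw ε).ne'

lemma expect_one : expect (fun _ : ι → ℝ => 1) = 1 := by
  simp only [expect, mul_one]
  rw [← Fintype.piFinset_univ, ← Finset.prod_univ_sum (fun _ : ι => Finset.univ)
    (fun _ k => nodeWeight k)]
  simp [sum_nodeWeight]

/-- Conditioning on all coordinates but one. -/
lemma expect_eq_expect_update (a : ι) (F : (ι → ℝ) → ℝ) :
    expect F = expect fun ξ => ∑ k, nodeWeight k * F (Function.update ξ a (node k)) := by
  -- Resampling: exchanging the coordinate `a` with an independent copy is an involution that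
  -- preserves the joint weight.
  have hinv : Function.Involutive (fun p : (ι → Fin 7) × Fin 7 =>
      (Function.update p.1 a p.2, p.1 a)) := by
    rintro ⟨ε, k⟩; simp
  have hw : ∀ (ε : ι → Fin 7) (k : Fin 7), (∏ i, nodeWeight (Function.update ε a k i)) *
      nodeWeight (ε a) = (∏ i, nodeWeight (ε i)) * nodeWeight k := by
    intro ε k
    rw [← Finset.mul_prod_erase _ _ (Finset.mem_univ a),
      ← Finset.mul_prod_erase _ (fun i => nodeWeight (ε i)) (Finset.mem_univ a)]
    have : ∏ i ∈ Finset.univ.erase a, nodeWeight (Function.update ε a k i) =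
        ∏ i ∈ Finset.univ.erase a, nodeWeight (ε i) :=
      Finset.prod_congr rfl fun i hi => by
        rw [Function.update_of_ne (Finset.ne_of_mem_erase hi)]
    rw [this]; simp; ring
  have h1 : expect (fun ξ => ∑ k, nodeWeight k * F (Function.update ξ a (node k))) =
      ∑ p : (ι → Fin 7) × Fin 7, (∏ i, nodeWeight (p.1 i)) * nodeWeight p.2 *
        F (fun i => node (Function.update p.1 a p.2 i)) := by
    rw [Fintype.sum_prod_type]
    simp only [expect, Finset.mul_sum]
    refine Finset.sum_congr rfl fun ε _ => Finset.sum_congr rfl fun k _ => ?_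
    have : (fun i => node (Function.update ε a k i)) =
        Function.update (fun i => node (ε i)) a (node k) := by
      ext i; by_cases h : i = a
      · subst h; simp
      · simp [h]
    rw [this]; ring
  have h2 : expect F = ∑ p : (ι → Fin 7) × Fin 7, (∏ i, nodeWeight (p.1 i)) * nodeWeight p.2 *
      F (fun i => node (p.1 i)) := by
    rw [Fintype.sum_prod_type]
    simp only [expect]
    refine Finset.sum_congr rfl fun ε _ => ?_
    have : ∀ k, (∏ i, nodeWeight (ε i)) * nodeWeight k * F (fun i => node (ε i)) =
      (∏ i, nodeWeight (ε i)) * F (fun i => node (ε i)) * nodeWeight k := fun k => by ring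
    simp only [this]
    rw [← Finset.mul_sum, sum_nodeWeight, mul_one]
  rw [h1, h2, ← Equiv.sum_comp hinv.toPerm]
  refine Finset.sum_congr rfl fun p _ => ?_
  simp only [Function.Involutive.coe_toPerm]
  rw [hw]

/-- `f` is affine in the coordinate `a` with slope `c`. -/
def IsAffineIn (a : ι) (c : ℝ) (f : (ι → ℝ) → ℝ) : Prop :=
  ∀ ξ t, f (Function.update ξ a t) = f (Function.update ξ a 0) + c * t

omit [Fintype ι] in
lemma isAffineIn_coord (a b : ι) : IsAffineIn a (if a = b then 1 else 0) (fun ξ => ξ b) := by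
  intro ξ t
  by_cases h : a = b
  · subst h; simp
  · simp [h, Function.update_of_ne (Ne.symm h)]

omit [Fintype ι] in
lemma isAffineIn_one (a : ι) : IsAffineIn a 0 (fun _ : ι → ℝ => 1) := by
  intro ξ t; simp

/-- Gaussian integration by parts, for products of five affine functions. -/
lemma expect_coord_mul (a : ι) {f₁ f₂ f₃ f₄ f₅ : (ι → ℝ) → ℝ} {c₁ c₂ c₃ c₄ c₅ : ℝ}
    (h₁ : IsAffineIn a c₁ f₁) (h₂ : IsAffineIn a c₂ f₂) (h₃ : IsAffineIn a c₃ f₃)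
    (h₄ : IsAffineIn a c₄ f₄) (h₅ : IsAffineIn a c₅ f₅) :
    expect (fun ξ => ξ a * (f₁ ξ * f₂ ξ * f₃ ξ * f₄ ξ * f₅ ξ)) =
      c₁ * expect (fun ξ => f₂ ξ * f₃ ξ * f₄ ξ * f₅ ξ) +
      c₂ * expect (fun ξ => f₁ ξ * f₃ ξ * f₄ ξ * f₅ ξ) +
      c₃ * expect (fun ξ => f₁ ξ * f₂ ξ * f₄ ξ * f₅ ξ) +
      c₄ * expect (fun ξ => f₁ ξ * f₂ ξ * f₃ ξ * f₅ ξ) +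
      c₅ * expect (fun ξ => f₁ ξ * f₂ ξ * f₃ ξ * f₄ ξ) := by
  simp only [← expect_const_mul, ← expect_add]
  -- With all coordinates but `a` frozen, the claim is a one-variable identity between polynomials
  -- in the node, of degree at most six, so the matching moments decide it.
  rw [expect_eq_expect_update a]
  conv_rhs => rw [expect_eq_expect_update a]
  congr 1
  ext ξ
  simp only [fun k => h₁ ξ (node k), fun k => h₂ ξ (node k), fun k => h₃ ξ (node k),
    fun k => h₄ ξ (node k), fun k => h₅ ξ (node k), Function.update_self]
  generalize f₁ (Function.update ξ a 0) = β₁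
  generalize f₂ (Function.update ξ a 0) = β₂
  generalize f₃ (Function.update ξ a 0) = β₃
  generalize f₄ (Function.update ξ a 0) = β₄
  generalize f₅ (Function.update ξ a 0) = β₅
  rw [sum_nodeWeight_mul (fun t => t * ((β₁ + c₁ * t) * (β₂ + c₂ * t) * (β₃ + c₃ * t) *
    (β₄ + c₄ * t) * (β₅ + c₅ * t))), sum_nodeWeight_mul (fun t =>
    c₁ * ((β₂ + c₂ * t) * (β₃ + c₃ * t) * (β₄ + c₄ * t) * (β₅ + c₅ * t)) +
    c₂ * ((β₁ + c₁ * t) * (β₃ + c₃ * t) * (β₄ + c₄ * t) * (β₅ + c₅ * t)) +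
    c₃ * ((β₁ + c₁ * t) * (β₂ + c₂ * t) * (β₄ + c₄ * t) * (β₅ + c₅ * t)) +
    c₄ * ((β₁ + c₁ * t) * (β₂ + c₂ * t) * (β₃ + c₃ * t) * (β₅ + c₅ * t)) +
    c₅ * ((β₁ + c₁ * t) * (β₂ + c₂ * t) * (β₃ + c₃ * t) * (β₄ + c₄ * t)))]
  ring

/-- The Kronecker symbol. -/
def kron (a b : ι) : ℝ := if a = b then 1 else 0

/-- The Wick formulas of orders two, four and six follow from integration by parts; missing factors
are filled with the constant `1`, which has slope `0`. -/
lemma expect_two (a b : ι) : expect (fun ξ : ι → ℝ => ξ a * ξ b) = kron a b := by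
  have := expect_coord_mul a (isAffineIn_coord a b) (isAffineIn_one a) (isAffineIn_one a)
    (isAffineIn_one a) (isAffineIn_one a)
  simp only [mul_one, expect_one, zero_mul, add_zero] at this
  exact this

lemma expect_four (a b c d : ι) : expect (fun ξ : ι → ℝ => ξ a * (ξ b * ξ c * ξ d)) =
    kron a b * kron c d + kron a c * kron b d + kron a d * kron b c := by
  have := expect_coord_mul a (isAffineIn_coord a b) (isAffineIn_coord a c)
    (isAffineIn_coord a d) (isAffineIn_one a) (isAffineIn_one a)
  simp only [mul_one, zero_mul, add_zero, expect_two] at this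
  exact this

lemma expect_six (a b c d e f : ι) :
    expect (fun ξ : ι → ℝ => ξ a * (ξ b * ξ c * ξ d * ξ e * ξ f)) =
    kron a b * (kron c d * kron e f + kron c e * kron d f + kron c f * kron d e) +
    kron a c * (kron b d * kron e f + kron b e * kron d f + kron b f * kron d e) +
    kron a d * (kron b c * kron e f + kron b e * kron c f + kron b f * kron c e) +
    kron a e * (kron b c * kron d f + kron b d * kron c f + kron b f * kron c d) +
    kron a f * (kron b c * kron d e + kron b d * kron c e + kron b e * kron c d) := by
  have := expect_coord_mul a (isAffineIn_coord a b) (isAffineIn_coord a c)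
    (isAffineIn_coord a d) (isAffineIn_coord a e) (isAffineIn_coord a f)
  simp only [mul_assoc] at this
  simp only [← mul_assoc (_ : ℝ) _ (_ * (_ * _) : ℝ)] at this
  have h4 : ∀ a b c d : ι, expect (fun ξ : ι → ℝ => ξ a * (ξ b * (ξ c * ξ d))) =
    kron a b * kron c d + kron a c * kron b d + kron a d * kron b c := fun a b c d => by
      rw [← expect_four]; simp only [mul_assoc]
  simp only [mul_assoc, h4] at this
  simp only [mul_assoc]
  exact this

/-- The expectation of a homogeneous polynomial of degree six. -/
lemma expect_sextic (G : ι → ι → ι → ι → ι → ι → ℝ) :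
    expect (fun ξ : ι → ℝ => ∑ a, ∑ b, ∑ c, ∑ d, ∑ e, ∑ f,
      G a b c d e f * (ξ a * (ξ b * ξ c * ξ d * ξ e * ξ f))) =
    ∑ p, ∑ q, ∑ r,
      (G p p q q r r + G p p q r q r + G p p q r r q +
       G p q p q r r + G p q p r q r + G p q p r r q +
       G p q q p r r + G p q r p q r + G p q r p r q +
       G p q q r p r + G p q r q p r + G p q r r p q +
       G p q q r r p + G p q r q r p + G p q r r q p) := by
  simp only [expect_sum, expect_const_mul, expect_six, mul_add, Finset.sum_add_distrib]
  simp only [kron, mul_ite, mul_one, mul_zero, Finset.sum_ite_eq, Finset.mem_univ, if_true,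
    Finset.sum_ite_irrel, Finset.sum_const_zero]
  ring

end Moments

/-! ### The Weitzenböck curvature term of a cubic form -/

section Weitzenboeck

variable {ι : Type*} [Fintype ι]

/-- A fivefold sum over the same index set. -/
def sumFive (f : ι → ι → ι → ι → ι → ℝ) : ℝ :=
  ∑ x : ι × ι × ι × ι × ι, f x.1 x.2.1 x.2.2.1 x.2.2.2.1 x.2.2.2.2

lemma sumFive_eq (f : ι → ι → ι → ι → ι → ℝ) :
    sumFive f = ∑ l, ∑ m, ∑ p, ∑ q, ∑ r, f l m p q r := by
  simp only [sumFive, Fintype.sum_prod_type]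

lemma sumFive_add (f g : ι → ι → ι → ι → ι → ℝ) :
    sumFive (fun l m p q r => f l m p q r + g l m p q r) = sumFive f + sumFive g :=
  Finset.sum_add_distrib

lemma sumFive_mul (c : ℝ) (f : ι → ι → ι → ι → ι → ℝ) :
    sumFive (fun l m p q r => c * f l m p q r) = c * sumFive f :=
  (Finset.mul_sum _ _ _).symm

/-- Reindexing by the transposition of `l` and `p` shows that the sum equals its own negative. -/
lemma sumFive_eq_zero_of_swap_left {f : ι → ι → ι → ι → ι → ℝ}
    (h : ∀ l m p q r, f p m l q r = - f l m p q r) : sumFive f = 0 := by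
  have : sumFive f = - sumFive f := by
    conv_rhs => rw [sumFive, ← Finset.sum_neg_distrib]
    refine Fintype.sum_equiv ⟨fun x => (x.2.2.1, x.2.1, x.1, x.2.2.2),
      fun x => (x.2.2.1, x.2.1, x.1, x.2.2.2), fun _ => rfl, fun _ => rfl⟩ _ _
      fun x => ?_
    change _ = - f x.2.2.1 x.2.1 x.1 x.2.2.2.1 x.2.2.2.2
    rw [h]
  linarith

lemma sumFive_eq_zero_of_swap_right {f : ι → ι → ι → ι → ι → ℝ}
    (h : ∀ l m p q r, f l q p m r = - f l m p q r) : sumFive f = 0 := by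
  have : sumFive f = - sumFive f := by
    conv_rhs => rw [sumFive, ← Finset.sum_neg_distrib]
    refine Fintype.sum_equiv ⟨fun x => (x.1, x.2.2.2.1, x.2.2.1, x.2.1, x.2.2.2.2),
      fun x => (x.1, x.2.2.2.1, x.2.2.1, x.2.1, x.2.2.2.2), fun _ => rfl, fun _ => rfl⟩ _ _
      fun x => ?_
    change _ = - f x.1 x.2.2.2.1 x.2.2.1 x.2.1 x.2.2.2.2
    rw [h]
  linarith

/-- The components in an orthonormal frame of a symmetric cubic form `A`, of an algebraic curvature
tensor `R`, and of the second covariant derivative `D` of `A`, such that the first covariant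
derivative of `A` is totally symmetric and the second covariant derivative of the trace of `A`
vanishes. -/
structure BochnerArrays (A : ι → ι → ι → ℝ) (R : ι → ι → ι → ι → ℝ)
    (D : ι → ι → ι → ι → ι → ℝ) : Prop where
  A_left : ∀ i j k, A i j k = A j i k
  A_right : ∀ i j k, A i j k = A i k j
  R_left : ∀ i j k l, R i j k l = - R j i k l
  R_right : ∀ i j k l, R i j k l = - R i j l k
  -- The first two indices of `D` are the directions of differentiation, the outer one first;
  -- exchanging the second and third indices is thus the total symmetry of the first derivative of
  -- `A`.
  D_left : ∀ h i j k l, D h i j k l = D h j i k l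
  D_mid : ∀ h i j k l, D h i j k l = D h i k j l
  ricci : ∀ i j k l m, D i j k l m - D j i k l m =
    - ∑ p, (R i j k p * A p l m + R i j l p * A k p m + R i j m p * A k l p)
  trace : ∀ i j m, ∑ l, D i j l l m = 0

namespace BochnerArrays

variable {A : ι → ι → ι → ℝ} {R : ι → ι → ι → ι → ℝ} {D : ι → ι → ι → ι → ι → ℝ}

/-- The curvature operator annihilates the trace of `A`. -/
lemma sum_R_mul_trace (H : BochnerArrays A R D) (i j k : ι) :
    ∑ p, R i j k p * ∑ l, A l l p = 0 := by
  -- The Ricci identity traced over two arguments of `A`: the left side is an alternation of `∇̂²τ`,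
  -- hence zero.
  have h1 : ∑ l, ∑ p, (R i j l p * A p l k + R i j l p * A l p k + R i j k p * A l l p) = 0 := by
    have := H.trace i j k
    have h2 := H.trace j i k
    have h3 : ∑ l, (D i j l l k - D j i l l k) = 0 := by
      rw [Finset.sum_sub_distrib, this, h2, sub_zero]
    simp only [H.ricci, Finset.sum_neg_distrib] at h3
    linarith
  -- Curvature acting on a contracted argument contributes nothing: a skew pair of indices meets a
  -- symmetric one.
  have h2 : ∑ l, ∑ p, R i j l p * A p l k = 0 := by
    have : ∑ l, ∑ p, R i j l p * A p l k = - ∑ l, ∑ p, R i j l p * A p l k := by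
      conv_lhs => rw [Finset.sum_comm]
      rw [← Finset.sum_neg_distrib]
      refine Finset.sum_congr rfl fun l _ => ?_
      rw [← Finset.sum_neg_distrib]
      refine Finset.sum_congr rfl fun p _ => ?_
      rw [H.R_right i j p l, H.A_left l p k]; ring
    linarith
  have h3 : ∑ l, ∑ p, R i j l p * A l p k = 0 := by
    rw [← h2]
    exact Finset.sum_congr rfl fun l _ => Finset.sum_congr rfl fun p _ => by rw [H.A_left]
  simp only [Finset.sum_add_distrib, h2, h3, zero_add] at h1
  rw [← h1, Finset.sum_comm]
  exact Finset.sum_congr rfl fun p _ => Finset.mul_sum _ _ _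

lemma A_rotate (H : BochnerArrays A R D) (i j k : ι) : A i j k = A k i j := by
  rw [H.A_right, H.A_left]

lemma A_reverse (H : BochnerArrays A R D) (i j k : ι) : A i j k = A k j i := by
  rw [H.A_left, H.A_rotate]

/-- The Bochner term `⟨ΔA, A⟩` as an average of sectional curvatures. -/
lemma two_mul_sum_eq_expect [DecidableEq ι] (H : BochnerArrays A R D) :
    2 * ∑ l, ∑ i, ∑ j, ∑ k, D l l i j k * A i j k =
      expect fun ξ : ι → ℝ => ∑ l, ∑ m, ∑ p, ∑ q, R l p q m *
        (∑ s, ∑ t, A s t l * (ξ s * ξ t)) * ξ p * ξ q * (∑ s, ∑ t, A s t m * (ξ s * ξ t)) := by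
  set t₁ : ℝ := sumFive fun l m p q r => R l p p m * (A q q l * A r r m) with ht₁
  set t₂ : ℝ := sumFive fun l m p q r => R l p p m * (A q r l * A q r m) with ht₂
  set t₃ : ℝ := sumFive fun l m p q r => R l p q m * (A q r l * A p r m) with ht₃
  have h₁ : t₁ = 0 := by
    rw [ht₁, sumFive_eq]
    refine Finset.sum_eq_zero fun l _ => ?_
    rw [Finset.sum_comm]
    refine Finset.sum_eq_zero fun p _ => ?_
    have := H.sum_R_mul_trace l p p
    have h2 : ∀ m, ∑ q, ∑ r, R l p p m * (A q q l * A r r m) =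
        (∑ q, A q q l) * (R l p p m * ∑ r, A r r m) := by
      intro m
      rw [Finset.sum_mul]
      refine Finset.sum_congr rfl fun _ _ => ?_
      simp only [Finset.mul_sum]
      exact Finset.sum_congr rfl fun _ _ => by ring
    simp only [h2]
    rw [← Finset.mul_sum, this, mul_zero]
  -- In the pairings of `hA` and `hB` a factor symmetric in `l`, `p` meets the skew pair of `R`; in
  -- `hC` the same happens for `q`, `m`.
  have hA : (sumFive fun l m p q r => R l p q m * (A p q l * A r r m)) = 0 :=
    sumFive_eq_zero_of_swap_left fun l m p q r => by
      rw [H.R_left p l, H.A_reverse l q p]; ring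
  have hB : (sumFive fun l m p q r => R l p q m * (A p r l * A q r m)) = 0 :=
    sumFive_eq_zero_of_swap_left fun l m p q r => by
      rw [H.R_left p l, H.A_reverse l r p]; ring
  have hC : (sumFive fun l m p q r => R l p q m * (A r r l * A p q m)) = 0 :=
    sumFive_eq_zero_of_swap_right fun l m p q r => by
      rw [H.R_right l p m q, H.A_right p m q]; ring
  have hE : (expect fun ξ : ι → ℝ => ∑ l, ∑ m, ∑ p, ∑ q, R l p q m *
        (∑ s, ∑ t, A s t l * (ξ s * ξ t)) * ξ p * ξ q *
        (∑ s, ∑ t, A s t m * (ξ s * ξ t))) = t₁ + 2 * t₂ + 4 * t₃ := by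
    -- The symmetry of `A` sorts the fifteen pairings into six types with multiplicities 1, 2, 4, 2,
    -- 4, 2.
    have hs : ∀ l m, (expect fun ξ : ι → ℝ => ∑ p, ∑ q, R l p q m *
        (∑ s, ∑ t, A s t l * (ξ s * ξ t)) * ξ p * ξ q *
        (∑ s, ∑ t, A s t m * (ξ s * ξ t))) = ∑ p, ∑ q, ∑ r,
        (R l p p m * (A q q l * A r r m) + 2 * (R l p p m * (A q r l * A q r m)) +
          4 * (R l p q m * (A q r l * A p r m)) + 2 * (R l p q m * (A p q l * A r r m)) +
          4 * (R l p q m * (A p r l * A q r m)) + 2 * (R l p q m * (A r r l * A p q m))) := by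
      intro l m
      have : (fun ξ : ι → ℝ => ∑ p, ∑ q, R l p q m *
        (∑ s, ∑ t, A s t l * (ξ s * ξ t)) * ξ p * ξ q *
        (∑ s, ∑ t, A s t m * (ξ s * ξ t))) = fun ξ => ∑ p, ∑ q, ∑ s, ∑ t, ∑ u, ∑ v,
          (R l p q m * A s t l * A u v m) * (ξ p * (ξ q * ξ s * ξ t * ξ u * ξ v)) := by
        ext ξ
        refine Finset.sum_congr rfl fun p _ => Finset.sum_congr rfl fun q _ => ?_
        simp only [Finset.mul_sum (s := Finset.univ) (a := R l p q m), Finset.sum_mul]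
        refine Finset.sum_congr rfl fun s _ => Finset.sum_congr rfl fun t _ => ?_
        simp only [Finset.mul_sum]
        exact Finset.sum_congr rfl fun u _ => Finset.sum_congr rfl fun v _ => by ring
      rw [this, expect_sextic]
      refine Finset.sum_congr rfl fun p _ => Finset.sum_congr rfl fun q _ =>
        Finset.sum_congr rfl fun r _ => ?_
      rw [H.A_left r q l, H.A_left r q m, H.A_left r p l, H.A_left r p m, H.A_left q p l,
        H.A_left q p m]
      ring
    simp only [expect_sum] at hs ⊢
    simp only [hs]
    rw [← sumFive_eq (fun l m p q r =>
        (R l p p m * (A q q l * A r r m) + 2 * (R l p p m * (A q r l * A q r m)) +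
          4 * (R l p q m * (A q r l * A p r m)) + 2 * (R l p q m * (A p q l * A r r m)) +
          4 * (R l p q m * (A p r l * A q r m)) + 2 * (R l p q m * (A r r l * A p q m))))]
    simp only [sumFive_add, sumFive_mul, hA, hB, hC]
    ring
  have hQ : ∑ l, ∑ i, ∑ j, ∑ k, D l l i j k * A i j k = t₂ + 2 * t₃ := by
    -- Total symmetry of `∇̂A` moves the inner derivative into an argument, the Ricci identity
    -- commutes the two derivatives, and total symmetry again produces a component whose trace over
    -- `l` is zero.
    have hD : ∀ l i j k, D l l i j k = D i j l l k -
        ∑ p, (R l i l p * A p j k + R l i j p * A l p k + R l i k p * A l j p) := by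
      intro l i j k
      have := H.ricci l i l j k
      rw [H.D_left l l i, H.D_left i j l, H.D_mid i l j]
      rw [← H.D_left i l l]
      linarith
    have h0 : ∑ l, ∑ i, ∑ j, ∑ k, D i j l l k * A i j k = 0 := by
      rw [Finset.sum_comm]
      refine Finset.sum_eq_zero fun i _ => ?_
      rw [Finset.sum_comm]
      refine Finset.sum_eq_zero fun j _ => ?_
      rw [Finset.sum_comm]
      refine Finset.sum_eq_zero fun k _ => ?_
      rw [← Finset.sum_mul, H.trace, zero_mul]
    simp only [hD, sub_mul, Finset.sum_sub_distrib, h0, Finset.sum_mul]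
    rw [← sumFive_eq (fun l i j k p =>
      (R l i l p * A p j k + R l i j p * A l p k + R l i k p * A l j p) * A i j k)]
    simp only [add_mul, sumFive_add]
    have e1 : (sumFive fun l i j k p => R l i l p * A p j k * A i j k) = - t₂ := by
      rw [ht₂, sumFive, sumFive, ← Finset.sum_neg_distrib]
      refine Fintype.sum_equiv ⟨fun x => (x.2.1, x.2.2.2.2, x.1, x.2.2.1, x.2.2.2.1),
        fun x => (x.2.2.1, x.1, x.2.2.2.1, x.2.2.2.2, x.2.1), fun _ => rfl, fun _ => rfl⟩ _ _ ?_
      rintro ⟨l, i, j, k, p⟩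
      simp only [Equiv.coe_fn_mk]
      rw [H.R_left l i, H.A_rotate j k i, H.A_rotate j k p]; ring
    have e2 : (sumFive fun l i j k p => R l i j p * A l p k * A i j k) = - t₃ := by
      rw [ht₃, sumFive, sumFive, ← Finset.sum_neg_distrib]
      refine Fintype.sum_equiv ⟨fun x => (x.2.1, x.2.2.2.2, x.1, x.2.2.1, x.2.2.2.1),
        fun x => (x.2.2.1, x.1, x.2.2.2.1, x.2.2.2.2, x.2.1), fun _ => rfl, fun _ => rfl⟩ _ _ ?_
      rintro ⟨l, i, j, k, p⟩
      simp only [Equiv.coe_fn_mk]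
      rw [H.R_left l i, H.A_rotate j k i, H.A_right l k p]; ring
    have e3 : (sumFive fun l i j k p => R l i k p * A l j p * A i j k) = - t₃ := by
      rw [ht₃, sumFive, sumFive, ← Finset.sum_neg_distrib]
      refine Fintype.sum_equiv ⟨fun x => (x.2.1, x.2.2.2.2, x.1, x.2.2.2.1, x.2.2.1),
        fun x => (x.2.2.1, x.1, x.2.2.2.2, x.2.2.2.1, x.2.1), fun _ => rfl, fun _ => rfl⟩ _ _ ?_
      rintro ⟨l, i, j, k, p⟩
      simp only [Equiv.coe_fn_mk]
      rw [H.R_left l i, H.A_reverse k j i]; ring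
    rw [e1, e2, e3]; ring
  rw [hE, hQ, h₁]; ring

/-- The Bochner term is nonnegative if the sectional curvature is. -/
lemma sum_nonneg (H : BochnerArrays A R D)
    (hR : ∀ η ξ : ι → ℝ, 0 ≤ ∑ l, ∑ m, ∑ p, ∑ q, R l p q m * η l * ξ p * ξ q * η m) :
    0 ≤ ∑ l, ∑ i, ∑ j, ∑ k, D l l i j k * A i j k := by
  classical
  have h := expect_nonneg (F := fun ξ : ι → ℝ => ∑ l, ∑ m, ∑ p, ∑ q, R l p q m *
        (∑ s, ∑ t, A s t l * (ξ s * ξ t)) * ξ p * ξ q * (∑ s, ∑ t, A s t m * (ξ s * ξ t)))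
    fun ξ => hR (fun l => ∑ s, ∑ t, A s t l * (ξ s * ξ t)) ξ
  have := H.two_mul_sum_eq_expect
  linarith

/-- If the Bochner term vanishes and the sectional curvature is positive, then so does `A`. -/
lemma eq_zero_of_sum_eq_zero [Nontrivial ι] (H : BochnerArrays A R D)
    (hR : ∀ η ξ : ι → ℝ, 0 ≤ ∑ l, ∑ m, ∑ p, ∑ q, R l p q m * η l * ξ p * ξ q * η m)
    (hR' : ∀ η ξ : ι → ℝ, ∑ l, ∑ m, ∑ p, ∑ q, R l p q m * η l * ξ p * ξ q * η m = 0 →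
      ∀ i j, ξ i * η j = ξ j * η i)
    (h0 : ∑ l, ∑ i, ∑ j, ∑ k, D l l i j k * A i j k = 0) (i j k : ι) : A i j k = 0 := by
  classical
  have hE := H.two_mul_sum_eq_expect
  rw [h0, mul_zero] at hE
  -- A vanishing average of nonnegative terms with positive weights vanishes at every node vector
  -- `ξ`, so `A(ξ, ξ, ·)` is parallel to `ξ` there.
  have hpar : ∀ (ε : ι → Fin 7) (i j : ι), node (ε i) * ∑ s, ∑ t, A s t j *
      (node (ε s) * node (ε t)) = node (ε j) * ∑ s, ∑ t, A s t i * (node (ε s) * node (ε t)) := by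
    intro ε
    exact hR' (fun l => ∑ s, ∑ t, A s t l * (node (ε s) * node (ε t))) (fun i => node (ε i))
      (eq_zero_of_expect_eq_zero (F := fun ξ : ι → ℝ => ∑ l, ∑ m, ∑ p, ∑ q, R l p q m *
        (∑ s, ∑ t, A s t l * (ξ s * ξ t)) * ξ p * ξ q * (∑ s, ∑ t, A s t m * (ξ s * ξ t)))
        (fun ξ => hR (fun l => ∑ s, ∑ t, A s t l * (ξ s * ξ t)) ξ) hE.symm ε)
  have n3 : node 3 = 0 := by norm_num [node]
  have n4 : node 4 = 1 := by norm_num [node]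
  have n2 : node 2 = -1 := by norm_num [node]
  -- The test vector is `e_a`.
  have h1 : ∀ a b, a ≠ b → A a a b = 0 := by
    intro a b hab
    have := hpar (fun i => if i = a then 4 else 3) a b
    simp only [apply_ite node, n3, n4, if_true, if_neg hab.symm] at this
    simpa [Finset.sum_ite_eq, hab.symm] using this
  -- The test vector is `e_a + t e_b` with `t = node x`.
  have key : ∀ a b, a ≠ b → ∀ x : Fin 7, ∀ i j,
      (if i = a then 1 else if i = b then node x else 0) * (A a a j + 2 * node x * A a b j +
        node x ^ 2 * A b b j) =
      (if j = a then 1 else if j = b then node x else 0) * (A a a i + 2 * node x * A a b i +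
        node x ^ 2 * A b b i) := by
    intro a b hab x i j
    have hsum : ∀ j, ∑ s, ∑ t, A s t j *
        ((if s = a then 1 else if s = b then node x else 0) *
        (if t = a then 1 else if t = b then node x else 0)) = A a a j + 2 * node x * A a b j +
        node x ^ 2 * A b b j := by
      intro j
      have hi : ∀ s : ι, (if s = a then 1 else if s = b then node x else 0) =
          (if s = a then (1 : ℝ) else 0) + (if s = b then node x else 0) := by
        intro s
        by_cases h : s = a
        · subst h; simp [hab]
        · simp [h]
      simp only [hi, mul_add, add_mul, Finset.sum_add_distrib]
      simp
      rw [H.A_left b a j]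
      ring
    have := hpar (fun i => if i = a then 4 else if i = b then x else 3) i j
    simp only [apply_ite node, n3, n4] at this
    rwa [hsum, hsum] at this
  have h3 : ∀ a, A a a a = 0 := by
    intro a
    obtain ⟨b, hb⟩ := exists_ne a
    -- Since the mixed components vanish by `h1`, the values `t = 1` and `t = -1` give `A b b b = A
    -- a a a` and `A b b b = -A a a a`.
    have k1 := key a b hb.symm 4 a b
    have k2 := key a b hb.symm 2 a b
    simp only [n4, n2, if_true, if_neg hb] at k1 k2
    have z1 := h1 a b hb.symm
    have z2 := h1 b a hb
    have z3 := H.A_right a b a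
    have z4 : A a b b = A b b a := by rw [H.A_rotate, H.A_rotate]
    rw [z3] at k1 k2
    rw [z4] at k1 k2
    linarith
  by_cases hij : i = j
  · subst hij
    by_cases hik : i = k
    · subst hik; exact h3 i
    · exact h1 i k hik
  by_cases hik : i = k
  · subst hik; rw [H.A_right]; exact h1 i j hij
  by_cases hjk : j = k
  · subst hjk; rw [H.A_rotate, H.A_rotate]; exact h1 j i (Ne.symm hij)
  -- For distinct indices, `ξ = e_i + e_j` has no component along `e_k`, so `A(ξ, ξ, e_k) = 0`,
  -- which polarizes to the claim.
  have k1 := key i j hij 4 i k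
  simp only [n4, if_true, if_neg (Ne.symm hik), if_neg (Ne.symm hjk)] at k1
  rw [h1 i k hik, h1 j k hjk] at k1
  linarith

end BochnerArrays

end Weitzenboeck

/-! ### The strong maximum principle -/

section MaximumPrinciple

open Filter Topology Metric
open scoped InnerProductSpace

section SecondDerivativeTest

variable {E : Type*} [NormedAddCommGroup E] [NormedSpace ℝ E]

lemma deriv_deriv_comp_line {v : E → ℝ} {x : E} (hv : ContDiffAt ℝ 2 v x) (e : E) :
    deriv (deriv fun t : ℝ => v (x + t • e)) 0 = fderiv ℝ (fderiv ℝ v) x e e := by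
  have hline : ∀ t : ℝ, HasDerivAt (fun t : ℝ => x + t • e) e t := fun t => by
    have := ((hasDerivAt_id t).smul_const e).const_add x
    rwa [one_smul] at this
  have hev : ∀ᶠ y in 𝓝 x, DifferentiableAt ℝ v y :=
    (hv.eventually (by simp)).mono fun y hy => hy.differentiableAt (by simp)
  have hx : x + (0 : ℝ) • e = x := by rw [zero_smul, add_zero]
  have htend : Tendsto (fun t : ℝ => x + t • e) (𝓝 0) (𝓝 x) := by
    have := (hline 0).continuousAt.tendsto
    rwa [hx] at this
  have h1 : deriv (fun t : ℝ => v (x + t • e)) =ᶠ[𝓝 0] fun t => fderiv ℝ v (x + t • e) e := by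
    filter_upwards [htend.eventually hev] with t ht
    exact (HasFDerivAt.comp_hasDerivAt (f := fun t : ℝ => x + t • e) t ht.hasFDerivAt
      (hline t)).deriv
  rw [h1.deriv_eq]
  have hd : DifferentiableAt ℝ (fderiv ℝ v) x :=
    (hv.fderiv_right (m := 1) (by norm_num)).differentiableAt (by simp)
  have h2 : HasFDerivAt (fderiv ℝ v) (fderiv ℝ (fderiv ℝ v) x) (x + (0 : ℝ) • e) := by
    rw [hx]; exact hd.hasFDerivAt
  have h3 : HasDerivAt (fun t : ℝ => fderiv ℝ v (x + t • e)) (fderiv ℝ (fderiv ℝ v) x e) 0 :=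
    HasFDerivAt.comp_hasDerivAt (f := fun t : ℝ => x + t • e) 0 h2 (hline 0)
  have h4 := h3.clm_apply (hasDerivAt_const (0 : ℝ) e)
  rw [h4.deriv]
  simp

/-- The second derivative is nonpositive at a local maximum. -/
lemma fderiv_fderiv_nonpos_of_isLocalMax {v : E → ℝ} {x : E} (hv : ContDiffAt ℝ 2 v x)
    (hmax : IsLocalMax v x) (e : E) : fderiv ℝ (fderiv ℝ v) x e e ≤ 0 := by
  by_contra! hpos
  rw [← deriv_deriv_comp_line hv e] at hpos
  have hline : ContinuousAt (fun t : ℝ => x + t • e) 0 := by fun_prop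
  have htend : Tendsto (fun t : ℝ => x + t • e) (𝓝 0) (𝓝 x) := by
    simpa using hline.tendsto
  have hmax' : IsLocalMax (fun t : ℝ => v (x + t • e)) 0 := by
    have := htend.eventually hmax
    simpa [IsLocalMax, IsMaxFilter] using this
  have hcont : ContinuousAt (fun t : ℝ => v (x + t • e)) 0 := by
    have : ContinuousAt v (x + (0 : ℝ) • e) := by simpa using hv.continuousAt
    exact ContinuousAt.comp (f := fun t : ℝ => x + t • e) this hline
  -- A positive second derivative would make the maximum along the line also a local minimum, so the
  -- function would be constant near it, with second derivative zero.
  have hmin := isLocalMin_of_deriv_deriv_pos hpos hmax'.deriv_eq_zero hcont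
  have hconst : (fun t : ℝ => v (x + t • e)) =ᶠ[𝓝 0] fun _ => v (x + (0 : ℝ) • e) := by
    filter_upwards [hmax', hmin] with t h1 h2 using le_antisymm h1 h2
  have h2 : deriv (fun t : ℝ => v (x + t • e)) =ᶠ[𝓝 0] fun _ => 0 := by
    have := hconst.deriv
    simpa using this
  rw [h2.deriv_eq] at hpos
  simp at hpos

end SecondDerivativeTest

variable {E : Type*} [NormedAddCommGroup E] [InnerProductSpace ℝ E]

/-- The radial barrier function in Hopf's lemma. -/
noncomputable def hopfBarrier (α : ℝ) (c x : E) : ℝ := Real.exp (-α * ‖x - c‖ ^ 2)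

lemma hasFDerivAt_hopfBarrier (α : ℝ) (c x : E) :
    HasFDerivAt (hopfBarrier α c) ((-2 * α * hopfBarrier α c x) • innerSL ℝ (x - c)) x := by
  have h1 : HasFDerivAt (fun x : E => ‖x - c‖ ^ 2) (2 • innerSL ℝ (x - c)) x := by
    simpa using ((hasFDerivAt_id x).sub_const c).norm_sq
  have h2 := (h1.const_mul (-α)).exp
  refine h2.congr_fderiv (ContinuousLinearMap.ext fun w => ?_)
  simp [hopfBarrier]
  ring

lemma contDiff_hopfBarrier (α : ℝ) (c : E) : ContDiff ℝ 2 (hopfBarrier α c) := by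
  unfold hopfBarrier
  exact (contDiff_const.mul ((contDiff_id.sub contDiff_const).norm_sq ℝ)).exp

lemma fderiv_fderiv_hopfBarrier (α : ℝ) (c x e : E) :
    fderiv ℝ (fderiv ℝ (hopfBarrier α c)) x e e =
      hopfBarrier α c x * (4 * α ^ 2 * ⟪x - c, e⟫_ℝ ^ 2 - 2 * α * ‖e‖ ^ 2) := by
  have h0 : fderiv ℝ (hopfBarrier α c) =
      fun x => (-2 * α * hopfBarrier α c x) • innerSL ℝ (x - c) :=
    funext fun x => (hasFDerivAt_hopfBarrier α c x).fderiv
  have h1 : HasFDerivAt (fun x : E => innerSL ℝ (x - c)) (innerSL ℝ : E →L[ℝ] E →L[ℝ] ℝ) x :=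
    (innerSL ℝ : E →L[ℝ] E →L[ℝ] ℝ).hasFDerivAt.comp x ((hasFDerivAt_id x).sub_const c)
  have h2 := ((hasFDerivAt_hopfBarrier α c x).const_mul (-2 * α)).smul h1
  rw [h0]
  refine (congrArg (fun L : E →L[ℝ] E →L[ℝ] ℝ => L e e) h2.fderiv).trans ?_
  have h3 : innerSL ℝ e e = ‖e‖ ^ 2 := real_inner_self_eq_norm_sq e
  simp [h3, inner_sub_left]
  ring

/-- **Hopf's strong maximum principle**: a function of class `C²` with a local maximum which is a
subsolution of a uniformly elliptic operator without zeroth order term is locally constant. -/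
theorem eventually_eq_of_isLocalMax_of_subsolution [FiniteDimensional ℝ E] {ι : Type*} [Fintype ι]
    {u : E → ℝ} {x₀ : E} {κ Λ : ℝ} (hκ : 0 < κ) (hu : ∀ᶠ x in 𝓝 x₀, ContDiffAt ℝ 2 u x)
    (hmax : ∀ᶠ x in 𝓝 x₀, u x ≤ u x₀)
    (hL : ∀ᶠ x in 𝓝 x₀, ∃ (e : ι → E) (b : E), ‖b‖ ≤ Λ ∧ (∀ i, ‖e i‖ ≤ Λ) ∧
      (∀ w, κ * ‖w‖ ^ 2 ≤ ∑ i, ⟪w, e i⟫_ℝ ^ 2) ∧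
      0 ≤ ∑ i, fderiv ℝ (fderiv ℝ u) x (e i) (e i) + fderiv ℝ u x b) :
    ∀ᶠ x in 𝓝 x₀, u x = u x₀ := by
  obtain ⟨r', hr', hball⟩ := Metric.eventually_nhds_iff_ball.1 (hu.and (hmax.and hL))
  -- The factor `4` leaves room: `x₁` lies within `r` of `x₀`, the nearest contact point `x₂` within
  -- `2 * r`, and a small ball about `x₂` still within `4 * r`.
  obtain ⟨r, hr, rfl⟩ : ∃ r, 0 < r ∧ r' = 4 * r := ⟨r' / 4, by positivity, by ring⟩
  refine Metric.eventually_nhds_iff_ball.2 ⟨r, hr, fun x₁ hx₁ => ?_⟩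
  by_contra hne
  have hcont : ContinuousOn u (closedBall x₀ (2 * r)) := fun x hx =>
    (hball x (closedBall_subset_ball (by linarith) hx)).1.continuousAt.continuousWithinAt
  have hF : IsCompact (closedBall x₀ (2 * r) ∩ u ⁻¹' {u x₀}) :=
    (isCompact_closedBall x₀ (2 * r)).of_isClosed_subset
      (hcont.preimage_isClosed_of_isClosed isClosed_closedBall isClosed_singleton)
      Set.inter_subset_left
  obtain ⟨x₂, hx₂, hmin⟩ := hF.exists_isMinOn ⟨x₀, by simp; linarith⟩
    (f := fun y => dist x₁ y) (by fun_prop)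
  set m := u x₀ with hm
  have hρr : dist x₁ x₂ < r := lt_of_le_of_lt (hmin ⟨by simp; linarith, rfl⟩) hx₁
  have hx₂m : u x₂ = m := hx₂.2
  have hx₁0 : dist x₁ x₀ < r := hx₁
  have hlt : ∀ y, dist x₁ y < dist x₁ x₂ → u y < m := by
    intro y hy
    have hy2 : dist y x₀ < 2 * r := by
      have := dist_triangle y x₁ x₀
      rw [dist_comm y x₁] at this
      linarith
    have hle := (hball y (by rw [mem_ball]; linarith)).2.1
    refine lt_of_le_of_ne hle fun h => ?_
    have := hmin (show y ∈ closedBall x₀ (2 * r) ∩ u ⁻¹' {m} from ⟨by simp; linarith, h⟩)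
    simp only [Set.mem_ofPred_eq] at this
    linarith
  -- Halving the ball about `x₁` towards `x₂` gives a ball, centred at the midpoint `c`, whose
  -- closure meets the contact set only at `x₂`.
  obtain ⟨w, hw⟩ : ∃ w, x₂ = x₁ + (w + w) := ⟨(2 : ℝ)⁻¹ • (x₂ - x₁), by
    rw [← add_smul]; norm_num⟩
  set c := x₁ + w with hc
  have hw0 : 0 < ‖w‖ := by
    rw [norm_pos_iff]
    rintro rfl
    apply hne
    rw [← hx₂m, hw]; simp
  have hx₂c : x₂ - c = w := by rw [hw, hc]; abel
  have hdist : dist x₁ x₂ = 2 * ‖w‖ := by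
    rw [hw, dist_eq_norm]
    have : x₁ - (x₁ + (w + w)) = -((2 : ℝ) • w) := by rw [two_smul]; abel
    rw [this, norm_neg, norm_smul]; norm_num
  have hcball : ∀ y, ‖y - c‖ ≤ ‖w‖ → y ≠ x₂ → u y < m := by
    intro y hy hy2
    apply hlt
    rw [hdist, dist_comm, dist_eq_norm]
    have h1 : y - x₁ = (y - c) + w := by rw [hc]; abel
    have h2 : y - x₂ = (y - c) - w := by rw [← hx₂c]; abel
    -- Strict convexity of the norm: a point of the half ball other than `x₂` lies strictly inside
    -- the original ball.
    have h3 := parallelogram_law_with_norm ℝ (y - c) w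
    have h4 : 0 < ‖(y - c) - w‖ := by
      rw [← h2, norm_pos_iff, sub_ne_zero]; exact hy2
    rw [h1]
    refine lt_of_pow_lt_pow_left₀ 2 (by positivity) ?_
    nlinarith [norm_nonneg (y - c)]
  set δ := ‖w‖ with hδ
  -- This radius keeps the ball about `x₂` away from `c`, where the gradient of the barrier
  -- degenerates.
  set s := δ / 2 with hs
  have hs0 : 0 < s := by positivity
  have hBsub : ∀ y ∈ closedBall x₂ s, y ∈ ball x₀ (4 * r) := by
    intro y hy
    have h1 : dist y x₂ ≤ s := hy
    have h2 := dist_triangle4 y x₂ x₁ x₀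
    rw [dist_comm x₂ x₁] at h2
    rw [mem_ball]
    linarith
  have hBc : ∀ y ∈ closedBall x₂ s, s ≤ ‖y - c‖ ∧ ‖y - c‖ ≤ 2 * δ := by
    intro y hy
    have h1 : ‖y - x₂‖ ≤ s := by rw [← dist_eq_norm]; exact hy
    have h2 : y - c = (y - x₂) + w := by rw [← hx₂c]; abel
    have h3 : w = (y - c) - (y - x₂) := by rw [h2]; abel
    constructor
    · have := norm_sub_le (y - c) (y - x₂)
      rw [← h3] at this
      linarith
    · have := norm_add_le (y - x₂) w
      rw [← h2] at this
      linarith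
  -- the exponent of the barrier
  obtain ⟨α, hα0, hα⟩ : ∃ α : ℝ, 0 < α ∧
      Fintype.card ι * Λ ^ 2 + Λ * (2 * δ) < 2 * α * (κ * s ^ 2) := by
    refine ⟨(|Fintype.card ι * Λ ^ 2 + Λ * (2 * δ)| + 1) / (2 * (κ * s ^ 2)), by positivity, ?_⟩
    have : 2 * ((|Fintype.card ι * Λ ^ 2 + Λ * (2 * δ)| + 1) / (2 * (κ * s ^ 2))) * (κ * s ^ 2) =
      |Fintype.card ι * Λ ^ 2 + Λ * (2 * δ)| + 1 := by
      field_simp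
    rw [this]
    linarith [le_abs_self (Fintype.card ι * Λ ^ 2 + Λ * (2 * δ))]
  -- `u` is bounded away from `m` on part of the boundary
  have hP : ∃ η > 0, ∀ y ∈ sphere x₂ s ∩ closedBall c δ, u y ≤ m - η := by
    have hPc : IsCompact (sphere x₂ s ∩ closedBall c δ) :=
      (isCompact_sphere x₂ s).inter_right isClosed_closedBall
    rcases (sphere x₂ s ∩ closedBall c δ).eq_empty_or_nonempty with h | h
    · exact ⟨1, one_pos, by simp [h]⟩
    · have hco : ContinuousOn u (sphere x₂ s ∩ closedBall c δ) := fun y hy =>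
        (hball y (hBsub y (sphere_subset_closedBall hy.1))).1.continuousAt.continuousWithinAt
      obtain ⟨y, hy, hymax⟩ := hPc.exists_isMaxOn h hco
      have hym : u y < m := by
        refine hcball y (by rw [← dist_eq_norm]; exact hy.2) ?_
        rintro rfl
        have : dist y y = s := hy.1
        rw [dist_self] at this
        linarith
      exact ⟨m - u y, by linarith, fun z hz => by have := hymax hz; simp at this; linarith⟩
  obtain ⟨η, hη, hPη⟩ := hP
  set h : E → ℝ := hopfBarrier α c with hh
  set β := Real.exp (-α * δ ^ 2) with hβ
  -- As `h ≤ 1`, the perturbation stays below the gap `η` on the part of the sphere lying in the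
  -- ball about `c`.
  set ε := η / 2 with hε
  have hh1 : ∀ y, h y ≤ 1 := fun y => Real.exp_le_one_iff.2 (by
    have : 0 ≤ α * ‖y - c‖ ^ 2 := by positivity
    linarith)
  have hx₂h : h x₂ = β := by rw [hh, hopfBarrier, hx₂c]
  have hvcont : ContinuousOn (fun y => u y + ε * h y) (closedBall x₂ s) := fun y hy =>
    ((hball y (hBsub y hy)).1.continuousAt.add
      (continuousAt_const.mul (contDiff_hopfBarrier α c).continuous.continuousAt)).continuousWithinAt
  obtain ⟨z, hz, hzmax⟩ := (isCompact_closedBall x₂ s).exists_isMaxOn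
    ⟨x₂, by simp [hs0.le]⟩ hvcont
  have hzge : m + ε * β ≤ u z + ε * h z := by
    have := hzmax (show x₂ ∈ closedBall x₂ s by simp [hs0.le])
    simp only [Set.mem_ofPred_eq, hx₂h, hx₂m] at this
    exact this
  have hβ0 : 0 < β := Real.exp_pos _
  -- On the sphere, inside the ball about `c` the gap `η` wins; outside it `h < β` and `u ≤ m`.
  -- Either way the perturbed function is below its value `m + ε * β` at `x₂`.
  have hzint : z ∈ ball x₂ s := by
    by_contra hnot
    have hzs : z ∈ sphere x₂ s := by
      rw [mem_sphere]
      rw [mem_ball, not_lt] at hnot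
      exact le_antisymm hz hnot
    by_cases hzc : z ∈ closedBall c δ
    · have h1 := hPη z ⟨hzs, hzc⟩
      have h2 := hh1 z
      have : 0 < ε * β := by positivity
      nlinarith
    · have h1 := (hball z (hBsub z hz)).2.1
      have h2 : h z < β := by
        rw [mem_closedBall, not_le, dist_eq_norm] at hzc
        refine Real.exp_lt_exp.2 ?_
        have : δ ^ 2 < ‖z - c‖ ^ 2 := pow_lt_pow_left₀ hzc hw0.le (by norm_num)
        nlinarith
      have : 0 < ε := by positivity
      nlinarith
  have hlm : IsLocalMax (fun y => u y + ε * h y) z :=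
    hzmax.isLocalMax (closedBall_mem_nhds_of_mem hzint)
  obtain ⟨hcd, -, e, b, hb, he, hell, hsub⟩ := hball z (hBsub z hz)
  have hhcd : ContDiffAt ℝ 2 h z := (contDiff_hopfBarrier α c).contDiffAt
  have hvcd : ContDiffAt ℝ 2 (fun y => u y + ε * h y) z := hcd.add (contDiffAt_const.mul hhcd)
  have hd1 : ∀ y, ContDiffAt ℝ 2 u y → fderiv ℝ (fun y => u y + ε * h y) y =
      fderiv ℝ u y + ε • fderiv ℝ h y := by
    intro y hy
    have h1 : DifferentiableAt ℝ h y :=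
      ((contDiff_hopfBarrier α c).differentiable (by simp)).differentiableAt
    rw [fderiv_fun_add (hy.differentiableAt (by simp)) (h1.const_mul ε), fderiv_const_mul h1]
  have hd2 : fderiv ℝ (fderiv ℝ (fun y => u y + ε * h y)) z =
      fderiv ℝ (fderiv ℝ u) z + ε • fderiv ℝ (fderiv ℝ h) z := by
    have hev : fderiv ℝ (fun y => u y + ε * h y) =ᶠ[𝓝 z]
        fun y => fderiv ℝ u y + ε • fderiv ℝ h y :=
      (hcd.eventually (by simp)).mono hd1
    rw [hev.fderiv_eq]
    have h1 : DifferentiableAt ℝ (fderiv ℝ u) z :=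
      (hcd.fderiv_right (m := 1) (by norm_num)).differentiableAt (by simp)
    have h2 : DifferentiableAt ℝ (fderiv ℝ h) z :=
      (hhcd.fderiv_right (m := 1) (by norm_num)).differentiableAt (by simp)
    exact (h1.hasFDerivAt.add (h2.hasFDerivAt.const_smul ε)).fderiv
  have hg := hlm.fderiv_eq_zero
  rw [hd1 z hcd] at hg
  have hgb : fderiv ℝ u z b + ε * fderiv ℝ h z b = 0 := by
    have := congrArg (fun L : E →L[ℝ] ℝ => L b) hg
    simpa using this
  have hsec : ∀ i, fderiv ℝ (fderiv ℝ u) z (e i) (e i) +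
      ε * fderiv ℝ (fderiv ℝ h) z (e i) (e i) ≤ 0 := by
    intro i
    have := fderiv_fderiv_nonpos_of_isLocalMax hvcd hlm (e i)
    rw [hd2] at this
    simpa using this
  have hsum : ∑ i, fderiv ℝ (fderiv ℝ u) z (e i) (e i) +
      ε * ∑ i, fderiv ℝ (fderiv ℝ h) z (e i) (e i) ≤ 0 := by
    rw [Finset.mul_sum, ← Finset.sum_add_distrib]
    exact Finset.sum_nonpos fun i _ => hsec i
  -- For the chosen `α` the quadratic term, bounded below by ellipticity and `s ≤ ‖z - c‖`,
  -- dominates the other two; so the barrier is a strict subsolution, incompatible with an interior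
  -- maximum of `u + ε * h`.
  have hLh : 0 < ∑ i, fderiv ℝ (fderiv ℝ h) z (e i) (e i) + fderiv ℝ h z b := by
    rw [hh, (hasFDerivAt_hopfBarrier α c z).fderiv]
    simp only [fderiv_fderiv_hopfBarrier, ← Finset.mul_sum, Finset.sum_sub_distrib]
    have hz1 := hBc z hz
    have hpos : 0 < hopfBarrier α c z := Real.exp_pos _
    have e1 : κ * s ^ 2 ≤ ∑ i, ⟪z - c, e i⟫_ℝ ^ 2 := by
      refine le_trans ?_ (hell (z - c))
      have : s ^ 2 ≤ ‖z - c‖ ^ 2 := pow_le_pow_left₀ hs0.le hz1.1 2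
      nlinarith
    have e2 : ∑ i, ‖e i‖ ^ 2 ≤ Fintype.card ι * Λ ^ 2 := by
      have := Finset.sum_le_card_nsmul Finset.univ (fun i => ‖e i‖ ^ 2) (Λ ^ 2)
        fun i _ => pow_le_pow_left₀ (norm_nonneg _) (he i) 2
      simpa using this
    have e3 : ⟪z - c, b⟫_ℝ ≤ Λ * (2 * δ) := by
      have h1 := real_inner_le_norm (z - c) b
      have h2 : ‖z - c‖ * ‖b‖ ≤ (2 * δ) * Λ :=
        mul_le_mul hz1.2 hb (norm_nonneg _) (by positivity)
      linarith
    simp only [smul_apply, innerSL_apply_apply, smul_eq_mul]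
    have e4 : hopfBarrier α c z * (4 * α ^ 2 * ∑ i, ⟪z - c, e i⟫_ℝ ^ 2 -
        2 * α * ∑ i, ‖e i‖ ^ 2) + -2 * α * hopfBarrier α c z * ⟪z - c, b⟫_ℝ =
        hopfBarrier α c z * (2 * α) * (2 * α * ∑ i, ⟪z - c, e i⟫_ℝ ^ 2 -
        ∑ i, ‖e i‖ ^ 2 - ⟪z - c, b⟫_ℝ) := by ring
    rw [e4]
    refine mul_pos (by positivity) ?_
    have : 2 * α * (κ * s ^ 2) ≤ 2 * α * ∑ i, ⟪z - c, e i⟫_ℝ ^ 2 :=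
      mul_le_mul_of_nonneg_left e1 (by positivity)
    linarith
  have hε0 : 0 < ε := by positivity
  nlinarith [mul_pos hε0 hLh]

end MaximumPrinciple

/-! ### The Levi-Civita connection of a metric on an open set -/

section LocalGeometry

set_option synthInstance.maxHeartbeats 200000

open Filter Topology

variable {E : Type*} [NormedAddCommGroup E] [NormedSpace ℝ E]

section Shortcuts

variable {F : Type*} [NormedAddCommGroup F] [NormedSpace ℝ F]

noncomputable instance instNormedAddCommGroupBilin : NormedAddCommGroup (E →L[ℝ] E →L[ℝ] F) :=
  inferInstance

noncomputable instance instNormedSpaceBilin : NormedSpace ℝ (E →L[ℝ] E →L[ℝ] F) := inferInstance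

noncomputable instance instNormedAddCommGroupTrilin :
    NormedAddCommGroup (E →L[ℝ] E →L[ℝ] E →L[ℝ] F) := inferInstance

noncomputable instance instNormedSpaceTrilin : NormedSpace ℝ (E →L[ℝ] E →L[ℝ] E →L[ℝ] F) :=
  inferInstance

end Shortcuts

lemma two_le_infty : (2 : WithTop ℕ∞) ≤ ∞ := ENat.LEInfty.out

lemma one_add_one_le_infty : (1 + 1 : WithTop ℕ∞) ≤ ∞ := by
  rw [one_add_one_eq_two]; exact two_le_infty

/-- A smooth metric `g` on an open set `U`. -/
structure IsMetricOn (g : E → E →L[ℝ] E →L[ℝ] ℝ) (U : Set E) : Prop where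
  isOpen : IsOpen U
  contDiffOn : ContDiffOn ℝ ∞ g U
  symm : ∀ y ∈ U, ∀ v w, g y v w = g y w v
  pos : ∀ y ∈ U, ∀ v, v ≠ 0 → 0 < g y v v

/-- A smooth connection `Γ` on an open set `U` which is torsion free and compatible with `g`. -/
structure IsLeviCivitaOn (g : E → E →L[ℝ] E →L[ℝ] ℝ) (Γ : E → E →L[ℝ] E →L[ℝ] E)
    (U : Set E) : Prop extends IsMetricOn g U where
  contDiffOn_conn : ContDiffOn ℝ ∞ Γ U
  conn_symm : ∀ y ∈ U, ∀ u v, Γ y u v = Γ y v u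
  compat : ∀ y ∈ U, ∀ u v w, fderiv ℝ g y u v w = g y (Γ y u v) w + g y v (Γ y u w)

lemma isInvertible_of_pos [FiniteDimensional ℝ E] {b : E →L[ℝ] E →L[ℝ] ℝ}
    (hb : ∀ v, v ≠ 0 → 0 < b v v) : b.IsInvertible := by
  have hinj : Function.Injective b := by
    refine (injective_iff_map_eq_zero b).2 fun v hv => ?_
    by_contra hne
    have := hb v hne
    rw [hv] at this
    simp at this
  have hfin : Module.finrank ℝ E = Module.finrank ℝ (E →L[ℝ] ℝ) := by
    rw [← (LinearMap.toContinuousLinearMap (𝕜 := ℝ) (E := E) (F' := ℝ)).finrank_eq]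
    exact Subspace.dual_finrank_eq.symm
  have hsurj : Function.Surjective b :=
    (LinearMap.injective_iff_surjective_of_finrank_eq_finrank hfin (f := b.toLinearMap)).1 hinj
  exact ⟨(LinearEquiv.ofBijective b.toLinearMap ⟨hinj, hsurj⟩).toContinuousLinearEquiv, by ext; rfl⟩

namespace IsMetricOn

variable {g : E → E →L[ℝ] E →L[ℝ] ℝ} {U : Set E}

lemma mem_nhds (h : IsMetricOn g U) {y : E} (hy : y ∈ U) : U ∈ 𝓝 y := h.isOpen.mem_nhds hy

lemma contDiffAt (h : IsMetricOn g U) {y : E} (hy : y ∈ U) : ContDiffAt ℝ ∞ g y :=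
  h.contDiffOn.contDiffAt (h.mem_nhds hy)

lemma differentiableAt (h : IsMetricOn g U) {y : E} (hy : y ∈ U) : DifferentiableAt ℝ g y :=
  (h.contDiffAt hy).differentiableAt (by simp)

lemma fderiv_symm (h : IsMetricOn g U) {y : E} (hy : y ∈ U) (u v w : E) :
    fderiv ℝ g y u v w = fderiv ℝ g y u w v := by
  have h1 : ∀ v w, HasFDerivAt (fun z => g z v w)
      (((fderiv ℝ g y).flip v).flip w) y := by
    intro v w
    have := ((h.differentiableAt hy).hasFDerivAt.clm_apply (hasFDerivAt_const v y)).clm_apply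
      (hasFDerivAt_const w y)
    refine this.congr_fderiv (ContinuousLinearMap.ext fun u => ?_)
    simp
  have h2 : (fun z => g z v w) =ᶠ[𝓝 y] fun z => g z w v := by
    filter_upwards [h.mem_nhds hy] with z hz using h.symm z hz v w
  have := (h1 v w).unique ((h1 w v).congr_of_eventuallyEq h2)
  simpa using congrArg (fun L : E →L[ℝ] ℝ => L u) this

lemma isInvertible [FiniteDimensional ℝ E] (h : IsMetricOn g U) {y : E} (hy : y ∈ U) :
    (g y).IsInvertible := isInvertible_of_pos (h.pos y hy)

lemma contDiffOn_inverse [FiniteDimensional ℝ E] (h : IsMetricOn g U) :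
    ContDiffOn ℝ ∞ (fun y => (g y).inverse) U := fun _ hy =>
  ((h.isInvertible hy).contDiffAt_map_inverse.comp_contDiffWithinAt _ (h.contDiffOn _ hy))

lemma ext_of_inner (h : IsMetricOn g U) {y : E} (hy : y ∈ U) {v w : E}
    (hvw : ∀ z, g y v z = g y w z) : v = w := by
  by_contra hne
  have := h.pos y hy (v - w) (sub_ne_zero.2 hne)
  simp [hvw] at this

end IsMetricOn

/-- The coefficients of the Levi-Civita connection as a continuous bilinear map. -/
noncomputable def christoffelL (g : E → E →L[ℝ] E →L[ℝ] ℝ) (y : E) : E →L[ℝ] E →L[ℝ] E :=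
  (ContinuousLinearMap.compL ℝ E (E →L[ℝ] ℝ) E (g y).inverse) ∘L ((1 / 2 : ℝ) •
    (fderiv ℝ g y + (fderiv ℝ g y).flip -
      (ContinuousLinearMap.flipₗᵢ ℝ E E ℝ : (E →L[ℝ] E →L[ℝ] ℝ) →L[ℝ] E →L[ℝ] E →L[ℝ] ℝ) ∘L
        (fderiv ℝ g y).flip))

lemma christoffelL_apply (g : E → E →L[ℝ] E →L[ℝ] ℝ) (y u v : E) :
    christoffelL g y u v = christoffel g y u v := by
  simp [christoffelL, christoffel]

/-- Koszul's formula determines the coefficients through `g`; torsion freeness and compatibility are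
linear combinations of its instances, using the symmetry of the derivative of `g`. -/
lemma isLeviCivitaOn_christoffelL [FiniteDimensional ℝ E] {g : E → E →L[ℝ] E →L[ℝ] ℝ} {U : Set E}
    (h : IsMetricOn g U) : IsLeviCivitaOn g (christoffelL g) U := by
  have hinner : ∀ y ∈ U, ∀ u v w, 2 * g y (christoffelL g y u v) w =
      fderiv ℝ g y u v w + fderiv ℝ g y v u w - fderiv ℝ g y w u v := by
    intro y hy u v w
    rw [christoffelL_apply, christoffel, (h.isInvertible hy).self_apply_inverse]
    simp
  refine { h with contDiffOn_conn := ?_, conn_symm := ?_, compat := ?_ }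
  · have hD : ContDiffOn ℝ ∞ (fderiv ℝ g) U :=
      h.contDiffOn.fderiv_of_isOpen h.isOpen (by simp)
    refine contDiffOn_clm_apply.2 fun u => contDiffOn_clm_apply.2 fun v => ?_
    simp only [christoffelL_apply, christoffel]
    refine h.contDiffOn_inverse.clm_apply (ContDiffOn.const_smul (1 / 2 : ℝ) ?_)
    refine contDiffOn_clm_apply.2 fun w => ?_
    simp only [sub_apply, add_apply, ContinuousLinearMap.flip_apply]
    have hc : ∀ a b c : E, ContDiffOn ℝ ∞ (fun y => fderiv ℝ g y a b c) U := fun a b c =>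
      ((hD.clm_apply contDiffOn_const).clm_apply contDiffOn_const).clm_apply contDiffOn_const
    exact ((hc _ _ _).add (hc _ _ _)).sub (hc _ _ _)
  · intro y hy u v
    refine h.ext_of_inner hy fun w => ?_
    have h1 := hinner y hy u v w
    have h2 := hinner y hy v u w
    have h3 := h.fderiv_symm hy w u v
    linarith
  · intro y hy u v w
    have h1 := hinner y hy u v w
    have h2 := hinner y hy u w v
    rw [h.symm y hy v]
    have h3 := h.fderiv_symm hy u w v
    have h4 := h.fderiv_symm hy w u v
    have h5 := h.fderiv_symm hy v u w
    linarith

end LocalGeometry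

/-! ### Curvature and covariant derivatives of cubic forms on an open set -/

section LocalTensors

set_option synthInstance.maxHeartbeats 200000

open Filter Topology

variable {E : Type*} [NormedAddCommGroup E] [NormedSpace ℝ E]

/-- The curvature tensor of a connection given by continuous bilinear maps. -/
noncomputable def curv (Γ : E → E →L[ℝ] E →L[ℝ] E) (y u v w : E) : E :=
  fderiv ℝ Γ y u v w - fderiv ℝ Γ y v u w + Γ y u (Γ y v w) - Γ y v (Γ y u w)

lemma fderiv_bilin_apply {F : Type*} [NormedAddCommGroup F] [NormedSpace ℝ F]
    {B : E → E →L[ℝ] E →L[ℝ] F} {y : E} (hB : DifferentiableAt ℝ B y) (X u v : E) :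
    fderiv ℝ (fun z => B z u v) y X = fderiv ℝ B y X u v := by
  have := (hB.hasFDerivAt.clm_apply (hasFDerivAt_const u y)).clm_apply (hasFDerivAt_const v y)
  rw [this.fderiv]
  simp

lemma fderiv_trilin_apply {T : E → E →L[ℝ] E →L[ℝ] E →L[ℝ] ℝ} {y : E}
    (hT : DifferentiableAt ℝ T y) (X u v w : E) :
    fderiv ℝ (fun z => T z u v w) y X = fderiv ℝ T y X u v w := by
  have := ((hT.hasFDerivAt.clm_apply (hasFDerivAt_const u y)).clm_apply
    (hasFDerivAt_const v y)).clm_apply (hasFDerivAt_const w y)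
  rw [this.fderiv]
  simp

lemma curvature_eq_curv {Γ : E → E →L[ℝ] E →L[ℝ] E} {y : E} (hΓ : DifferentiableAt ℝ Γ y)
    (u v w : E) : curvature (fun y u v => Γ y u v) y u v w = curv Γ y u v w := by
  rw [curvature, curv, fderiv_bilin_apply hΓ, fderiv_bilin_apply hΓ]

lemma curv_swap (Γ : E → E →L[ℝ] E →L[ℝ] E) (y u v w : E) :
    curv Γ y u v w = - curv Γ y v u w := by
  simp only [curv]; abel

lemma curv_add_left (Γ : E → E →L[ℝ] E →L[ℝ] E) (y u u' v w : E) :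
    curv Γ y (u + u') v w = curv Γ y u v w + curv Γ y u' v w := by
  simp only [curv, map_add, add_apply]; abel

lemma curv_smul_left (Γ : E → E →L[ℝ] E →L[ℝ] E) (y u v w : E) (c : ℝ) :
    curv Γ y (c • u) v w = c • curv Γ y u v w := by
  simp only [curv, map_smul, smul_apply, smul_sub, smul_add]

namespace IsLeviCivitaOn

variable {g : E → E →L[ℝ] E →L[ℝ] ℝ} {Γ : E → E →L[ℝ] E →L[ℝ] E} {U : Set E}

lemma differentiableAt_conn (h : IsLeviCivitaOn g Γ U) {y : E} (hy : y ∈ U) :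
    DifferentiableAt ℝ Γ y :=
  (h.contDiffOn_conn.contDiffAt (h.mem_nhds hy)).differentiableAt (by simp)

/-- The curvature operators of the Levi-Civita connection are skew-symmetric. -/
lemma inner_curv_swap (h : IsLeviCivitaOn g Γ U) {y : E} (hy : y ∈ U) (u v w z : E) :
    g y (curv Γ y u v w) z = - g y (curv Γ y u v z) w := by
  have hΓ := (h.differentiableAt_conn hy).hasFDerivAt
  have hg := (h.differentiableAt hy).hasFDerivAt
  have hDg : DifferentiableAt ℝ (fderiv ℝ g) y :=
    ((h.contDiffAt hy).fderiv_right one_add_one_le_infty).differentiableAt (by simp)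
  -- Differentiating metric compatibility once more; the symmetry of the second derivative of `g`
  -- turns the alternation in `u`, `v` into the skew-symmetry of the curvature.
  have hD : ∀ u v, fderiv ℝ (fderiv ℝ g) y u v w z =
      (fderiv ℝ g y u (Γ y v w) z + g y (fderiv ℝ Γ y u v w) z) +
      (fderiv ℝ g y u w (Γ y v z) + g y w (fderiv ℝ Γ y u v z)) := by
    intro u v
    rw [← fderiv_trilin_apply hDg]
    have hev : (fun x => fderiv ℝ g x v w z) =ᶠ[𝓝 y]
        fun x => g x (Γ x v w) z + g x w (Γ x v z) := by
      filter_upwards [h.mem_nhds hy] with x hx using h.compat x hx v w z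
    rw [hev.fderiv_eq]
    have hΓ' : ∀ w, HasFDerivAt (fun x => Γ x v w) (((fderiv ℝ Γ y).flip v).flip w) y := by
      intro w
      refine ((hΓ.clm_apply (hasFDerivAt_const v y)).clm_apply
        (hasFDerivAt_const w y)).congr_fderiv (ContinuousLinearMap.ext fun u => ?_)
      simp
    have h1 := (hg.clm_apply (hΓ' w)).clm_apply (hasFDerivAt_const z y)
    have h2 := (hg.clm_apply (hasFDerivAt_const w y)).clm_apply (hΓ' z)
    rw [(h1.fun_add h2).fderiv]
    simp
    ring
  have hsymm : fderiv ℝ (fderiv ℝ g) y u v = fderiv ℝ (fderiv ℝ g) y v u :=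
    (((h.contDiffAt hy).of_le two_le_infty).isSymmSndFDerivAt (by simp)).eq u v
  have e1 := hD u v
  have e2 := hD v u
  rw [hsymm] at e1
  simp only [h.compat y hy] at e1 e2
  have e3 := h.symm y hy w (curv Γ y u v z)
  simp only [curv, map_add, map_sub, add_apply, sub_apply] at e3 ⊢
  linarith

end IsLeviCivitaOn

/-- The derivation of trilinear forms given by an endomorphism. -/
noncomputable def act (B : E →L[ℝ] E) (T : E →L[ℝ] E →L[ℝ] E →L[ℝ] ℝ) :
    E →L[ℝ] E →L[ℝ] E →L[ℝ] ℝ :=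
  T ∘L B + (ContinuousLinearMap.compL ℝ E E (E →L[ℝ] ℝ)).flip B ∘L T +
    ContinuousLinearMap.compL ℝ E (E →L[ℝ] ℝ) (E →L[ℝ] ℝ)
      ((ContinuousLinearMap.compL ℝ E E ℝ).flip B) ∘L T

lemma act_apply (B : E →L[ℝ] E) (T : E →L[ℝ] E →L[ℝ] E →L[ℝ] ℝ) (u v w : E) :
    act B T u v w = T (B u) v w + T u (B v) w + T u v (B w) := by
  simp [act]

/-- The covariant derivative in the direction `X` of a field of trilinear forms. -/
noncomputable def nabla (Γ : E → E →L[ℝ] E →L[ℝ] E) (T : E → E →L[ℝ] E →L[ℝ] E →L[ℝ] ℝ)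
    (y X : E) : E →L[ℝ] E →L[ℝ] E →L[ℝ] ℝ :=
  fderiv ℝ T y X - act (Γ y X) (T y)

lemma nabla_apply (Γ : E → E →L[ℝ] E →L[ℝ] E) (T : E → E →L[ℝ] E →L[ℝ] E →L[ℝ] ℝ)
    (y X u v w : E) : nabla Γ T y X u v w = fderiv ℝ T y X u v w -
      (T y (Γ y X u) v w + T y u (Γ y X v) w + T y u v (Γ y X w)) := by
  simp [nabla, act_apply]

lemma contDiffOn_trilin_iff [FiniteDimensional ℝ E] {T : E → E →L[ℝ] E →L[ℝ] E →L[ℝ] ℝ}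
    {U : Set E} :
    ContDiffOn ℝ ∞ T U ↔ ∀ u v w, ContDiffOn ℝ ∞ (fun y => T y u v w) U := by
  rw [contDiffOn_clm_apply]
  refine forall_congr' fun u => ?_
  rw [contDiffOn_clm_apply]
  exact forall_congr' fun v => contDiffOn_clm_apply

lemma contDiffOn_nabla [FiniteDimensional ℝ E] {Γ : E → E →L[ℝ] E →L[ℝ] E}
    {T : E → E →L[ℝ] E →L[ℝ] E →L[ℝ] ℝ} {U : Set E} (hU : IsOpen U) (hΓ : ContDiffOn ℝ ∞ Γ U)
    (hT : ContDiffOn ℝ ∞ T U) (X : E) : ContDiffOn ℝ ∞ (fun y => nabla Γ T y X) U := by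
  refine contDiffOn_trilin_iff.2 fun u v w => ?_
  simp only [nabla_apply]
  have hD : ContDiffOn ℝ ∞ (fun y => fderiv ℝ T y X) U :=
    (hT.fderiv_of_isOpen hU (by simp)).clm_apply contDiffOn_const
  have hc : ∀ u, ContDiffOn ℝ ∞ (fun y => Γ y X u) U := fun u =>
    (hΓ.clm_apply contDiffOn_const).clm_apply contDiffOn_const
  have hk : ∀ u : E, ContDiffOn ℝ ∞ (fun _ : E => u) U := fun u => contDiffOn_const
  have happ : ∀ {a b c : E → E}, ContDiffOn ℝ ∞ a U → ContDiffOn ℝ ∞ b U → ContDiffOn ℝ ∞ c U →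
      ContDiffOn ℝ ∞ (fun y => T y (a y) (b y) (c y)) U := fun ha hb hc =>
    ((hT.clm_apply ha).clm_apply hb).clm_apply hc
  exact (contDiffOn_trilin_iff.1 hD u v w).sub (((happ (hc u) (hk v) (hk w)).add
    (happ (hk u) (hc v) (hk w))).add (happ (hk u) (hk v) (hc w)))

/-- The second covariant derivative of a field of trilinear forms. -/
noncomputable def nablaSq (Γ : E → E →L[ℝ] E →L[ℝ] E) (T : E → E →L[ℝ] E →L[ℝ] E →L[ℝ] ℝ)
    (y X Y : E) : E →L[ℝ] E →L[ℝ] E →L[ℝ] ℝ :=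
  nabla Γ (fun z => nabla Γ T z Y) y X - nabla Γ T y (Γ y X Y)

lemma hasFDerivAt_trilin_apply {T : E → E →L[ℝ] E →L[ℝ] E →L[ℝ] ℝ} {y : E} {a b c : E → E}
    {a' b' c' : E →L[ℝ] E} (hT : DifferentiableAt ℝ T y) (ha : HasFDerivAt a a' y)
    (hb : HasFDerivAt b b' y) (hc : HasFDerivAt c c' y) :
    DifferentiableAt ℝ (fun z => T z (a z) (b z) (c z)) y ∧ ∀ X,
    fderiv ℝ (fun z => T z (a z) (b z) (c z)) y X = fderiv ℝ T y X (a y) (b y) (c y) +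
      T y (a' X) (b y) (c y) + T y (a y) (b' X) (c y) + T y (a y) (b y) (c' X) := by
  have h := ((hT.hasFDerivAt.clm_apply ha).clm_apply hb).clm_apply hc
  refine ⟨h.differentiableAt, fun X => ?_⟩
  rw [h.fderiv]
  simp
  ring

/-- The Ricci identity for a field of trilinear forms. -/
lemma nablaSq_sub_nablaSq [FiniteDimensional ℝ E] {Γ : E → E →L[ℝ] E →L[ℝ] E}
    {T : E → E →L[ℝ] E →L[ℝ] E →L[ℝ] ℝ} {U : Set E} (hU : IsOpen U) (hΓ : ContDiffOn ℝ ∞ Γ U)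
    (hT : ContDiffOn ℝ ∞ T U) {y : E} (hy : y ∈ U) (hsymm : ∀ u v, Γ y u v = Γ y v u)
    (X Y u v w : E) :
    nablaSq Γ T y X Y u v w - nablaSq Γ T y Y X u v w =
      - (T y (curv Γ y X Y u) v w + T y u (curv Γ y X Y v) w + T y u v (curv Γ y X Y w)) := by
  have hUy := hU.mem_nhds hy
  have hΓd : DifferentiableAt ℝ Γ y := (hΓ.contDiffAt hUy).differentiableAt (by simp)
  have hTd : DifferentiableAt ℝ T y := (hT.contDiffAt hUy).differentiableAt (by simp)
  have hDT : DifferentiableAt ℝ (fderiv ℝ T) y :=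
    ((hT.contDiffAt hUy).fderiv_right one_add_one_le_infty).differentiableAt (by simp)
  have hΓ' : ∀ Y w, HasFDerivAt (fun x => Γ x Y w) (((fderiv ℝ Γ y).flip Y).flip w) y := by
    intro Y w
    refine ((hΓd.hasFDerivAt.clm_apply (hasFDerivAt_const Y y)).clm_apply
      (hasFDerivAt_const w y)).congr_fderiv (ContinuousLinearMap.ext fun u => ?_)
    simp
  have hsnd : fderiv ℝ (fderiv ℝ T) y X Y = fderiv ℝ (fderiv ℝ T) y Y X :=
    (((hT.contDiffAt hUy).of_le two_le_infty).isSymmSndFDerivAt (by simp)).eq X Y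
  have hDD : ∀ X Y, fderiv ℝ (fun z => nabla Γ T z Y) y X u v w =
      fderiv ℝ (fderiv ℝ T) y X Y u v w -
      (fderiv ℝ T y X (Γ y Y u) v w + T y (fderiv ℝ Γ y X Y u) v w +
       fderiv ℝ T y X u (Γ y Y v) w + T y u (fderiv ℝ Γ y X Y v) w +
       fderiv ℝ T y X u v (Γ y Y w) + T y u v (fderiv ℝ Γ y X Y w)) := by
    intro X Y
    rw [← fderiv_trilin_apply (((contDiffOn_nabla hU hΓ hT Y).contDiffAt hUy).differentiableAt
      (by simp))]
    simp only [nabla_apply]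
    have hDTY : HasFDerivAt (fun z => fderiv ℝ T z Y) ((fderiv ℝ (fderiv ℝ T) y).flip Y) y := by
      refine (hDT.hasFDerivAt.clm_apply (hasFDerivAt_const Y y)).congr_fderiv
        (ContinuousLinearMap.ext fun u => ?_)
      simp
    have k0 := hasFDerivAt_trilin_apply hDTY.differentiableAt (hasFDerivAt_const u y)
      (hasFDerivAt_const v y) (hasFDerivAt_const w y)
    have k1 := hasFDerivAt_trilin_apply hTd (hΓ' Y u)
      (hasFDerivAt_const v y) (hasFDerivAt_const w y)
    have k2 := hasFDerivAt_trilin_apply hTd (hasFDerivAt_const u y) (hΓ' Y v)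
      (hasFDerivAt_const w y)
    have k3 := hasFDerivAt_trilin_apply hTd (hasFDerivAt_const u y) (hasFDerivAt_const v y)
      (hΓ' Y w)
    have := k0.1.hasFDerivAt.fun_sub ((k1.1.hasFDerivAt.fun_add k2.1.hasFDerivAt).fun_add
      k3.1.hasFDerivAt)
    rw [this.fderiv]
    simp only [sub_apply, add_apply, k0.2, k1.2, k2.2, k3.2, hDTY.fderiv]
    simp
    ring
  -- Second derivatives of `T` cancel by symmetry and the correction terms `Γ y X Y` by torsion
  -- freeness; what remains assembles into curvature.
  simp only [nablaSq, sub_apply]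
  rw [nabla_apply Γ (fun z => nabla Γ T z Y), nabla_apply Γ (fun z => nabla Γ T z X), hDD, hDD,
    hsnd, hsymm Y X]
  simp only [nabla_apply, curv, map_add, map_sub, add_apply, sub_apply]
  ring

end LocalTensors

/-! ### Orthonormal frames -/

section Frames

set_option synthInstance.maxHeartbeats 200000

open Filter Topology

variable {E : Type*} [NormedAddCommGroup E] [NormedSpace ℝ E] {ι : Type*} [Fintype ι]
  [DecidableEq ι]

/-- An orthonormal basis for a symmetric bilinear form. -/
structure IsOrthoFrame (b : E →L[ℝ] E →L[ℝ] ℝ) (F : ι → E) : Prop where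
  symm : ∀ v w, b v w = b w v
  orth : ∀ i j, b (F i) (F j) = if i = j then 1 else 0
  expand : ∀ v, v = ∑ i, b v (F i) • F i

lemma linearIndependent_of_orth {b : E →L[ℝ] E →L[ℝ] ℝ} {F : ι → E}
    (orth : ∀ i j, b (F i) (F j) = if i = j then 1 else 0) : LinearIndependent ℝ F := by
  refine Fintype.linearIndependent_iff.2 fun c hc j => ?_
  have := congrArg (fun v => b v (F j)) hc
  simpa [map_sum, orth, sum_apply] using this

/-- The defect of the expansion is orthogonal to a spanning set, hence to itself, and positivity
makes it zero. -/
lemma isOrthoFrame_of_orth [FiniteDimensional ℝ E] {b : E →L[ℝ] E →L[ℝ] ℝ} {F : ι → E}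
    (symm : ∀ v w, b v w = b w v) (pos : ∀ v, v ≠ 0 → 0 < b v v)
    (orth : ∀ i j, b (F i) (F j) = if i = j then 1 else 0)
    (hcard : Fintype.card ι = Module.finrank ℝ E) : IsOrthoFrame b F := by
  refine ⟨symm, orth, fun v => ?_⟩
  have hspan := (linearIndependent_of_orth orth).span_eq_top_of_card_eq_finrank' hcard
  set v' := v - ∑ i, b v (F i) • F i with hv'
  have h0 : ∀ j, b v' (F j) = 0 := by
    intro j
    simp [hv', map_sum, orth, sum_apply]
  have h1 : ∀ w, b v' w = 0 := by
    intro w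
    have hw : w ∈ Submodule.span ℝ (Set.range F) := by rw [hspan]; trivial
    induction hw using Submodule.span_induction with
    | mem x hx => obtain ⟨j, rfl⟩ := hx; exact h0 j
    | zero => simp
    | add x y _ _ hx hy => rw [map_add, hx, hy, add_zero]
    | smul c x _ hx => rw [map_smul, hx, smul_zero]
  have : v' = 0 := by
    by_contra hne
    exact (pos v' hne).ne' (h1 v')
  rwa [hv', sub_eq_zero] at this

namespace IsOrthoFrame

variable {b : E →L[ℝ] E →L[ℝ] ℝ} {F : ι → E}

lemma sum_mul (h : IsOrthoFrame b F) (v w : E) : ∑ i, b v (F i) * b w (F i) = b v w := by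
  conv_rhs => rw [h.expand v]
  simp only [map_sum, map_smul, sum_apply, smul_apply, smul_eq_mul]
  exact Finset.sum_congr rfl fun i _ => by rw [h.symm (F i) w]

/-- The trace of a bilinear form does not depend on the orthonormal frame. -/
lemma trace_eq {ι' : Type*} [Fintype ι'] [DecidableEq ι'] {F' : ι' → E} (h : IsOrthoFrame b F)
    (h' : IsOrthoFrame b F') (B : E →L[ℝ] E →L[ℝ] ℝ) :
    ∑ j, B (F' j) (F' j) = ∑ i, B (F i) (F i) := by
  have h1 : ∀ j, B (F' j) (F' j) = ∑ i, ∑ k, (b (F' j) (F i) * b (F' j) (F k)) * B (F i) (F k) := by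
    intro j
    conv_lhs => rw [h.expand (F' j)]
    simp only [map_sum, map_smul, sum_apply, smul_apply, smul_eq_mul, Finset.mul_sum]
    rw [Finset.sum_comm]
    exact Finset.sum_congr rfl fun i _ => Finset.sum_congr rfl fun k _ => by ring
  simp only [h1]
  rw [Finset.sum_comm]
  refine Finset.sum_congr rfl fun i _ => ?_
  rw [Finset.sum_comm]
  simp only [← Finset.sum_mul]
  have h2 : ∀ k, ∑ j, b (F' j) (F i) * b (F' j) (F k) = if i = k then 1 else 0 := by
    intro k
    rw [← h.orth, ← h'.sum_mul]
    exact Finset.sum_congr rfl fun j _ => by rw [h.symm (F' j), h.symm (F' j)]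
  simp [h2]

/-- An infinitesimal rotation of an orthonormal frame does not change traces. -/
lemma sum_rotation_eq_zero (h : IsOrthoFrame b F) {W : ι → E}
    (hW : ∀ i j, b (W i) (F j) + b (F i) (W j) = 0) (B : E →L[ℝ] E →L[ℝ] ℝ) :
    ∑ i, (B (W i) (F i) + B (F i) (W i)) = 0 := by
  have h1 : ∀ i, B (W i) (F i) + B (F i) (W i) =
      ∑ m, b (W i) (F m) * (B (F m) (F i) + B (F i) (F m)) := by
    intro i
    conv_lhs => rw [h.expand (W i)]
    simp only [map_sum, map_smul, sum_apply, smul_apply, smul_eq_mul, ← Finset.sum_add_distrib]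
    exact Finset.sum_congr rfl fun m _ => by ring
  simp only [h1]
  -- The rotation matrix is skew and the symmetrized form is symmetric, so the double sum is its own
  -- negative.
  have h2 : ∑ i, ∑ m, b (W i) (F m) * (B (F m) (F i) + B (F i) (F m)) =
      - ∑ i, ∑ m, b (W i) (F m) * (B (F m) (F i) + B (F i) (F m)) := by
    conv_lhs => rw [Finset.sum_comm]
    rw [← Finset.sum_neg_distrib]
    refine Finset.sum_congr rfl fun i _ => ?_
    rw [← Finset.sum_neg_distrib]
    refine Finset.sum_congr rfl fun m _ => ?_
    have := hW m i
    rw [h.symm (F m)] at this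
    rw [eq_neg_of_add_eq_zero_left this]; ring
  linarith

end IsOrthoFrame

/-- The inner product of two trilinear forms, computed in a frame. -/
noncomputable def pairing (S T : E →L[ℝ] E →L[ℝ] E →L[ℝ] ℝ) (F : ι → E) : ℝ :=
  ∑ i, ∑ j, ∑ k, S (F i) (F j) (F k) * T (F i) (F j) (F k)

omit [DecidableEq ι] in
lemma pairing_comm (S T : E →L[ℝ] E →L[ℝ] E →L[ℝ] ℝ) (F : ι → E) :
    pairing S T F = pairing T S F := by
  simp only [pairing, mul_comm]

omit [DecidableEq ι] in
lemma pairing_sub_left (S S' T : E →L[ℝ] E →L[ℝ] E →L[ℝ] ℝ) (F : ι → E) :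
    pairing (S - S') T F = pairing S T F - pairing S' T F := by
  simp only [pairing, sub_apply, sub_mul, Finset.sum_sub_distrib]

omit [DecidableEq ι] in
lemma pairing_self_nonneg (T : E →L[ℝ] E →L[ℝ] E →L[ℝ] ℝ) (F : ι → E) : 0 ≤ pairing T T F :=
  Finset.sum_nonneg fun _ _ => Finset.sum_nonneg fun _ _ => Finset.sum_nonneg fun _ _ =>
    mul_self_nonneg _

lemma eq_zero_of_pairing_self_eq_zero {b : E →L[ℝ] E →L[ℝ] ℝ} {F : ι → E}
    (h : IsOrthoFrame b F) {T : E →L[ℝ] E →L[ℝ] E →L[ℝ] ℝ} (hT : pairing T T F = 0) (u v w : E) :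
    T u v w = 0 := by
  have h1 : ∀ i j k, T (F i) (F j) (F k) = 0 := by
    intro i j k
    have e1 := (Finset.sum_eq_zero_iff_of_nonneg fun i _ => Finset.sum_nonneg fun j _ =>
      Finset.sum_nonneg fun k _ => mul_self_nonneg (T (F i) (F j) (F k))).1 hT i (Finset.mem_univ _)
    have e2 := (Finset.sum_eq_zero_iff_of_nonneg fun j _ =>
      Finset.sum_nonneg fun k _ => mul_self_nonneg (T (F i) (F j) (F k))).1 e1 j (Finset.mem_univ _)
    have e3 := (Finset.sum_eq_zero_iff_of_nonneg fun k _ =>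
      mul_self_nonneg (T (F i) (F j) (F k))).1 e2 k (Finset.mem_univ _)
    exact mul_self_eq_zero.1 e3
  rw [h.expand u, h.expand v, h.expand w]
  simp [map_sum, sum_apply, h1]

/-- The inner product of two trilinear forms does not depend on the orthonormal frame. -/
lemma pairing_eq {ι' : Type*} [Fintype ι'] [DecidableEq ι'] {b : E →L[ℝ] E →L[ℝ] ℝ} {F : ι → E}
    {F' : ι' → E} (h : IsOrthoFrame b F) (h' : IsOrthoFrame b F')
    (S T : E →L[ℝ] E →L[ℝ] E →L[ℝ] ℝ) : pairing S T F' = pairing S T F := by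
  -- The frame is changed in one argument at a time, each change being a trace of a bilinear form.
  have h3 : ∀ i j, ∑ k, S (F' i) (F' j) (F' k) * T (F' i) (F' j) (F' k) =
      ∑ k, S (F' i) (F' j) (F k) * T (F' i) (F' j) (F k) := fun i j => by
    simpa using h.trace_eq h' ((S (F' i) (F' j)).smulRight (T (F' i) (F' j)))
  have h2 : ∀ i k, ∑ j, S (F' i) (F' j) (F k) * T (F' i) (F' j) (F k) =
      ∑ j, S (F' i) (F j) (F k) * T (F' i) (F j) (F k) := fun i k => by
    simpa using h.trace_eq h' (((S (F' i)).flip (F k)).smulRight ((T (F' i)).flip (F k)))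
  have h1 : ∀ j k, ∑ i, S (F' i) (F j) (F k) * T (F' i) (F j) (F k) =
      ∑ i, S (F i) (F j) (F k) * T (F i) (F j) (F k) := fun j k => by
    simpa using h.trace_eq h' (((S.flip (F j)).flip (F k)).smulRight ((T.flip (F j)).flip (F k)))
  calc pairing S T F' = ∑ i, ∑ j, ∑ k, S (F' i) (F' j) (F k) * T (F' i) (F' j) (F k) :=
        Finset.sum_congr rfl fun i _ => Finset.sum_congr rfl fun j _ => h3 i j
    _ = ∑ i, ∑ k, ∑ j, S (F' i) (F' j) (F k) * T (F' i) (F' j) (F k) :=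
        Finset.sum_congr rfl fun i _ => Finset.sum_comm
    _ = ∑ i, ∑ k, ∑ j, S (F' i) (F j) (F k) * T (F' i) (F j) (F k) :=
        Finset.sum_congr rfl fun i _ => Finset.sum_congr rfl fun k _ => h2 i k
    _ = ∑ k, ∑ j, ∑ i, S (F' i) (F j) (F k) * T (F' i) (F j) (F k) := by
        rw [Finset.sum_comm]
        exact Finset.sum_congr rfl fun k _ => Finset.sum_comm
    _ = ∑ k, ∑ j, ∑ i, S (F i) (F j) (F k) * T (F i) (F j) (F k) :=
        Finset.sum_congr rfl fun k _ => Finset.sum_congr rfl fun j _ => h1 j k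
    _ = pairing S T F := by
        rw [Finset.sum_congr rfl fun k _ => Finset.sum_comm, Finset.sum_comm]
        exact Finset.sum_congr rfl fun i _ => Finset.sum_comm

/-- A smooth orthonormal frame of a metric on an open set. -/
structure IsFrameOn (g : E → E →L[ℝ] E →L[ℝ] ℝ) (F : ι → E → E) (V : Set E) : Prop where
  isOpen : IsOpen V
  contDiffOn : ∀ i, ContDiffOn ℝ ∞ (F i) V
  orthoFrame : ∀ y ∈ V, IsOrthoFrame (g y) fun i => F i y

/-- Gram–Schmidt with parameters: a constant vector outside the span at `y₀` is projected and
normalized, on the smaller neighbourhood where its projection has nonzero length. -/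
lemma exists_orthonormal_fields [FiniteDimensional ℝ E] {g : E → E →L[ℝ] E →L[ℝ] ℝ} {U : Set E}
    (h : IsMetricOn g U) {y₀ : E} (hy₀ : y₀ ∈ U) (k : ℕ) (hk : k ≤ Module.finrank ℝ E) :
    ∃ V ⊆ U, IsOpen V ∧ y₀ ∈ V ∧ ∃ F : Fin k → E → E, (∀ i, ContDiffOn ℝ ∞ (F i) V) ∧
      ∀ y ∈ V, ∀ i j, g y (F i y) (F j y) = if i = j then 1 else 0 := by
  induction k with
  | zero =>
    exact ⟨U, subset_rfl, h.isOpen, hy₀, fun i => i.elim0, fun i => i.elim0, fun _ _ i => i.elim0⟩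
  | succ k ih =>
    obtain ⟨V, hVU, hV, hyV, F, hF, hO⟩ := ih (by omega)
    obtain ⟨v, hv⟩ : ∃ v, v ∉ Submodule.span ℝ (Set.range fun i => F i y₀) := by
      by_contra! hall
      have htop : Submodule.span ℝ (Set.range fun i => F i y₀) = ⊤ :=
        Submodule.eq_top_iff'.2 hall
      have := finrank_range_le_card (R := ℝ) (fun i => F i y₀)
      rw [Set.finrank, htop, finrank_top, Fintype.card_fin] at this
      omega
    set w : E → E := fun y => v - ∑ i, g y v (F i y) • F i y with hw
    have hgV := h.contDiffOn.mono hVU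
    have hwV : ContDiffOn ℝ ∞ w V := by
      refine contDiffOn_const.sub (ContDiffOn.sum fun i _ => ?_)
      exact ((hgV.clm_apply contDiffOn_const).clm_apply (hF i)).smul (hF i)
    have hq : ContDiffOn ℝ ∞ (fun y => g y (w y) (w y)) V := (hgV.clm_apply hwV).clm_apply hwV
    have hw0 : w y₀ ≠ 0 := by
      intro h0
      apply hv
      rw [hw] at h0
      rw [sub_eq_zero.1 h0]
      exact Submodule.sum_mem _ fun i _ => Submodule.smul_mem _ _
        (Submodule.subset_span ⟨i, rfl⟩)
    have hwF : ∀ y ∈ V, ∀ j, g y (w y) (F j y) = 0 := by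
      intro y hy j
      simp [hw, map_sum, hO y hy, sum_apply]
    set N : E → E := fun y => (√(g y (w y) (w y)))⁻¹ • w y with hN
    set V' := V ∩ (fun y => g y (w y) (w y)) ⁻¹' Set.Ioi 0 with hV'
    have hNF : ∀ y ∈ V', ∀ j, g y (N y) (F j y) = 0 := by
      intro y hy j
      simp [hN, hwF y hy.1 j]
    refine ⟨V', fun y hy => hVU hy.1, hq.continuousOn.isOpen_inter_preimage hV isOpen_Ioi,
      ⟨hyV, h.pos y₀ hy₀ _ hw0⟩, Fin.snoc F N, fun i => ?_, fun y hy i j => ?_⟩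
    · refine Fin.lastCases ?_ (fun i => ?_) i
      · rw [Fin.snoc_last]
        have hpos : ∀ y ∈ V', g y (w y) (w y) ≠ 0 := fun y hy => (ne_of_gt hy.2)
        refine (((hq.mono Set.inter_subset_left).sqrt hpos).inv fun y hy => ?_).smul
          (hwV.mono Set.inter_subset_left)
        exact (Real.sqrt_pos.2 hy.2).ne'
      · rw [Fin.snoc_castSucc]
        exact (hF i).mono Set.inter_subset_left
    · refine Fin.lastCases ?_ (fun i => ?_) i <;> refine Fin.lastCases ?_ (fun j => ?_) j
      · simp only [Fin.snoc_last, if_true]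
        have hp : 0 < g y (w y) (w y) := hy.2
        simp only [hN, map_smul, smul_apply, smul_eq_mul]
        rw [← mul_assoc, ← mul_inv, Real.mul_self_sqrt hp.le, inv_mul_cancel₀ hp.ne']
      · simp only [Fin.snoc_last, Fin.snoc_castSucc]
        rw [hNF y hy, if_neg (Fin.castSucc_lt_last j).ne']
      · simp only [Fin.snoc_last, Fin.snoc_castSucc]
        rw [h.symm y (hVU hy.1), hNF y hy, if_neg (Fin.castSucc_lt_last i).ne]
      · simp only [Fin.snoc_castSucc, hO y hy.1, Fin.castSucc_inj]

/-- A smooth orthonormal frame exists in a neighbourhood of each point. -/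
lemma exists_isFrameOn [FiniteDimensional ℝ E] {g : E → E →L[ℝ] E →L[ℝ] ℝ} {U : Set E}
    (h : IsMetricOn g U) {y₀ : E} (hy₀ : y₀ ∈ U) :
    ∃ V ⊆ U, y₀ ∈ V ∧ ∃ F : Fin (Module.finrank ℝ E) → E → E, IsFrameOn g F V := by
  obtain ⟨V, hVU, hV, hy, F, hF, hO⟩ := exists_orthonormal_fields h hy₀ _ le_rfl
  exact ⟨V, hVU, hy, F, hV, hF, fun y hy => isOrthoFrame_of_orth (h.symm y (hVU hy))
    (h.pos y (hVU hy)) (hO y hy) (by simp)⟩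

end Frames

/-! ### Bochner's formula for a cubic form on an open set -/

section LocalBochner

set_option synthInstance.maxHeartbeats 200000

open Filter Topology

variable {E : Type*} [NormedAddCommGroup E] [NormedSpace ℝ E] {ι : Type*} [Fintype ι]
  [DecidableEq ι] {g : E → E →L[ℝ] E →L[ℝ] ℝ} {Γ : E → E →L[ℝ] E →L[ℝ] E} {U V : Set E}
  {F : ι → E → E}

namespace IsFrameOn

lemma differentiableAt (hF : IsFrameOn g F V) {y : E} (hy : y ∈ V) (i : ι) :
    DifferentiableAt ℝ (F i) y :=
  ((hF.contDiffOn i).contDiffAt (hF.isOpen.mem_nhds hy)).differentiableAt (by simp)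

/-- The covariant derivative of an orthonormal frame is an infinitesimal rotation. -/
lemma rotation (hF : IsFrameOn g F V) (h : IsLeviCivitaOn g Γ U) (hVU : V ⊆ U) {y : E}
    (hy : y ∈ V) (X : E) (i j : ι) :
    g y (fderiv ℝ (F i) y X + Γ y X (F i y)) (F j y) +
      g y (F i y) (fderiv ℝ (F j) y X + Γ y X (F j y)) = 0 := by
  have h1 := ((h.differentiableAt (hVU hy)).hasFDerivAt.clm_apply
    (hF.differentiableAt hy i).hasFDerivAt).clm_apply (hF.differentiableAt hy j).hasFDerivAt
  have h2 : (fun z => g z (F i z) (F j z)) =ᶠ[𝓝 y] fun _ => if i = j then 1 else 0 := by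
    filter_upwards [hF.isOpen.mem_nhds hy] with z hz using (hF.orthoFrame z hz).orth i j
  have h3 := h1.unique ((hasFDerivAt_const _ y).congr_of_eventuallyEq h2)
  have h4 := congrArg (fun L : E →L[ℝ] ℝ => L X) h3
  simp only [add_apply, ContinuousLinearMap.comp_apply, ContinuousLinearMap.flip_apply,
    zero_apply, h.compat y (hVU hy)] at h4
  simp only [map_add, add_apply]
  linarith

lemma hasFDerivAt_trilin (hF : IsFrameOn g F V) {y : E} (hy : y ∈ V)
    {T : E → E →L[ℝ] E →L[ℝ] E →L[ℝ] ℝ} (hT : DifferentiableAt ℝ T y) (i j k : ι) :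
    DifferentiableAt ℝ (fun z => T z (F i z) (F j z) (F k z)) y ∧ ∀ X,
    fderiv ℝ (fun z => T z (F i z) (F j z) (F k z)) y X = nabla Γ T y X (F i y) (F j y) (F k y) +
      (T y (fderiv ℝ (F i) y X + Γ y X (F i y)) (F j y) (F k y) +
       T y (F i y) (fderiv ℝ (F j) y X + Γ y X (F j y)) (F k y) +
       T y (F i y) (F j y) (fderiv ℝ (F k) y X + Γ y X (F k y))) := by
  have := hasFDerivAt_trilin_apply hT (hF.differentiableAt hy i).hasFDerivAt
    (hF.differentiableAt hy j).hasFDerivAt (hF.differentiableAt hy k).hasFDerivAt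
  refine ⟨this.1, fun X => ?_⟩
  rw [this.2, nabla_apply]
  simp only [map_add, add_apply]
  ring

/-- Covariant differentiation of the inner product of two fields of trilinear forms. -/
lemma fderiv_pairing (hF : IsFrameOn g F V) (h : IsLeviCivitaOn g Γ U) (hVU : V ⊆ U) {y : E}
    (hy : y ∈ V) {S T : E → E →L[ℝ] E →L[ℝ] E →L[ℝ] ℝ} (hS : DifferentiableAt ℝ S y)
    (hT : DifferentiableAt ℝ T y) (X : E) :
    fderiv ℝ (fun z => pairing (S z) (T z) fun i => F i z) y X =
      pairing (nabla Γ S y X) (T y) (fun i => F i y) +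
      pairing (S y) (nabla Γ T y X) (fun i => F i y) := by
  obtain ⟨W, hWdef⟩ : ∃ W : ι → E, ∀ i, W i = fderiv ℝ (F i) y X + Γ y X (F i y) :=
    ⟨_, fun _ => rfl⟩
  have hW := hF.rotation h hVU hy X
  simp only [← hWdef] at hW
  have hO := hF.orthoFrame y hy
  have h1 : ∀ i j k, HasFDerivAt
      (fun z => S z (F i z) (F j z) (F k z) * T z (F i z) (F j z) (F k z)) _ y := fun i j k =>
    (hF.hasFDerivAt_trilin (Γ := Γ) hy hS i j k).1.hasFDerivAt.mul
      (hF.hasFDerivAt_trilin (Γ := Γ) hy hT i j k).1.hasFDerivAt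
  have h2 := HasFDerivAt.fun_sum (u := Finset.univ) fun i _ =>
    HasFDerivAt.fun_sum (u := Finset.univ) fun j _ =>
    HasFDerivAt.fun_sum (u := Finset.univ) fun k _ => h1 i j k
  have h3 : fderiv ℝ (fun z => pairing (S z) (T z) fun i => F i z) y = _ := h2.fderiv
  rw [h3]
  simp only [sum_apply, add_apply, smul_apply, smul_eq_mul,
    (hF.hasFDerivAt_trilin (Γ := Γ) hy hS _ _ _).2, (hF.hasFDerivAt_trilin (Γ := Γ) hy hT _ _ _).2, ← hWdef]
  -- The terms in which the frame is differentiated cancel separately in each argument, as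
  -- infinitesimal rotations.
  have r1 : ∑ i, ∑ j, ∑ k, (S y (W i) (F j y) (F k y) * T y (F i y) (F j y) (F k y) +
      S y (F i y) (F j y) (F k y) * T y (W i) (F j y) (F k y)) = 0 := by
    rw [Finset.sum_comm]
    refine Finset.sum_eq_zero fun j _ => ?_
    rw [Finset.sum_comm]
    refine Finset.sum_eq_zero fun k _ => ?_
    simpa using hO.sum_rotation_eq_zero hW
      ((((S y).flip (F j y)).flip (F k y)).smulRight (((T y).flip (F j y)).flip (F k y)))
  have r2 : ∑ i, ∑ j, ∑ k, (S y (F i y) (W j) (F k y) * T y (F i y) (F j y) (F k y) +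
      S y (F i y) (F j y) (F k y) * T y (F i y) (W j) (F k y)) = 0 := by
    refine Finset.sum_eq_zero fun i _ => ?_
    rw [Finset.sum_comm]
    refine Finset.sum_eq_zero fun k _ => ?_
    simpa using hO.sum_rotation_eq_zero hW
      (((S y (F i y)).flip (F k y)).smulRight ((T y (F i y)).flip (F k y)))
  have r3 : ∑ i, ∑ j, ∑ k, (S y (F i y) (F j y) (W k) * T y (F i y) (F j y) (F k y) +
      S y (F i y) (F j y) (F k y) * T y (F i y) (F j y) (W k)) = 0 := by
    refine Finset.sum_eq_zero fun i _ => Finset.sum_eq_zero fun j _ => ?_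
    simpa using hO.sum_rotation_eq_zero hW
      ((S y (F i y) (F j y)).smulRight (T y (F i y) (F j y)))
  simp only [pairing]
  rw [← add_zero (∑ i, ∑ j, ∑ k, nabla Γ S y X (F i y) (F j y) (F k y) *
    T y (F i y) (F j y) (F k y) + _), ← r3, ← add_zero (_ + _ + _), ← r2, ← add_zero (_ + _ + _),
    ← r1]
  simp only [← Finset.sum_add_distrib]
  exact Finset.sum_congr rfl fun i _ => Finset.sum_congr rfl fun j _ =>
    Finset.sum_congr rfl fun k _ => by ring

/-- Covariant differentiation of the trace of a field of trilinear forms. -/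
lemma fderiv_trace (hF : IsFrameOn g F V) (h : IsLeviCivitaOn g Γ U) (hVU : V ⊆ U) {y : E}
    (hy : y ∈ V) {T : E → E →L[ℝ] E →L[ℝ] E →L[ℝ] ℝ} (hT : DifferentiableAt ℝ T y) (X w : E) :
    fderiv ℝ (fun z => ∑ i, T z (F i z) (F i z) w) y X =
      ∑ i, nabla Γ T y X (F i y) (F i y) w + ∑ i, T y (F i y) (F i y) (Γ y X w) := by
  obtain ⟨W, hWdef⟩ : ∃ W : ι → E, ∀ i, W i = fderiv ℝ (F i) y X + Γ y X (F i y) :=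
    ⟨_, fun _ => rfl⟩
  have hW := hF.rotation h hVU hy X
  simp only [← hWdef] at hW
  have h1 := fun i => hasFDerivAt_trilin_apply hT (hF.differentiableAt hy i).hasFDerivAt
    (hF.differentiableAt hy i).hasFDerivAt (hasFDerivAt_const w y)
  have h2 := HasFDerivAt.fun_sum (u := Finset.univ) fun i _ => (h1 i).1.hasFDerivAt
  have r := (hF.orthoFrame y hy).sum_rotation_eq_zero hW
    (ContinuousLinearMap.compL ℝ E (E →L[ℝ] ℝ) ℝ (ContinuousLinearMap.apply ℝ ℝ w) ∘L T y)
  simp only [ContinuousLinearMap.comp_apply, ContinuousLinearMap.compL_apply,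
    ContinuousLinearMap.apply_apply] at r
  rw [h2.fderiv]
  simp only [sum_apply, (h1 _).2, nabla_apply]
  rw [← add_zero (∑ i, (_ - _) + _), ← r, ← Finset.sum_add_distrib, ← Finset.sum_add_distrib]
  refine Finset.sum_congr rfl fun i _ => ?_
  simp only [hWdef, map_add, add_apply, zero_apply, map_zero]
  ring

/-- Bochner's formula for the second derivatives of the squared norm of a cubic form. -/
lemma fderiv_fderiv_normSq [FiniteDimensional ℝ E] (hF : IsFrameOn g F V)
    (h : IsLeviCivitaOn g Γ U) (hVU : V ⊆ U) {T : E → E →L[ℝ] E →L[ℝ] E →L[ℝ] ℝ}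
    (hT : ContDiffOn ℝ ∞ T U) {φ : E → ℝ}
    (hφ : ∀ z ∈ V, φ z = pairing (T z) (T z) fun i => F i z) {y : E} (hy : y ∈ V) (X : E) :
    ContDiffAt ℝ 2 φ y ∧ fderiv ℝ (fderiv ℝ φ) y X X - fderiv ℝ φ y (Γ y X X) =
      2 * pairing (nablaSq Γ T y X X) (T y) (fun i => F i y) +
      2 * pairing (nabla Γ T y X) (nabla Γ T y X) (fun i => F i y) := by
  have hd : ∀ z ∈ V, DifferentiableAt ℝ T z := fun z hz =>
    (hT.contDiffAt (h.mem_nhds (hVU hz))).differentiableAt (by simp)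
  have hnd : ∀ z ∈ V, ∀ X, DifferentiableAt ℝ (fun z => nabla Γ T z X) z := fun z hz X =>
    ((contDiffOn_nabla h.isOpen h.contDiffOn_conn hT X).contDiffAt
      (h.mem_nhds (hVU hz))).differentiableAt (by simp)
  have hsm : ContDiffOn ℝ ∞ φ V := by
    have hTV := hT.mono hVU
    have : ContDiffOn ℝ ∞ (fun z => pairing (T z) (T z) fun i => F i z) V := by
      refine ContDiffOn.sum fun i _ => ContDiffOn.sum fun j _ => ContDiffOn.sum fun k _ => ?_
      have := ((hTV.clm_apply (hF.contDiffOn i)).clm_apply (hF.contDiffOn j)).clm_apply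
        (hF.contDiffOn k)
      exact this.mul this
    exact this.congr hφ
  have hcd : ContDiffAt ℝ 2 φ y :=
    (hsm.contDiffAt (hF.isOpen.mem_nhds hy)).of_le two_le_infty
  refine ⟨hcd, ?_⟩
  have h1 : ∀ z ∈ V, ∀ X, fderiv ℝ φ z X =
      2 * pairing (nabla Γ T z X) (T z) (fun i => F i z) := by
    intro z hz X
    have hev : φ =ᶠ[𝓝 z] fun z => pairing (T z) (T z) fun i => F i z := by
      filter_upwards [hF.isOpen.mem_nhds hz] with x hx using hφ x hx
    rw [hev.fderiv_eq, hF.fderiv_pairing h hVU hz (hd z hz) (hd z hz), pairing_comm (T z)]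
    ring
  have h2 : fderiv ℝ (fderiv ℝ φ) y X X = fderiv ℝ (fun z => fderiv ℝ φ z X) y X := by
    have hD : DifferentiableAt ℝ (fderiv ℝ φ) y :=
      (hcd.fderiv_right (m := 1) (by norm_num)).differentiableAt (by simp)
    rw [(hD.hasFDerivAt.clm_apply (hasFDerivAt_const X y)).fderiv]
    simp
  have h3 : (fun z => fderiv ℝ φ z X) =ᶠ[𝓝 y]
      fun z => 2 * pairing (nabla Γ T z X) (T z) (fun i => F i z) := by
    filter_upwards [hF.isOpen.mem_nhds hy] with z hz using h1 z hz X
  have hpd : DifferentiableAt ℝ (fun z => pairing (nabla Γ T z X) (T z) fun i => F i z) y := by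
    refine DifferentiableAt.fun_sum fun i _ => DifferentiableAt.fun_sum fun j _ =>
      DifferentiableAt.fun_sum fun k _ => ?_
    exact (hF.hasFDerivAt_trilin (Γ := Γ) hy (hnd y hy X) i j k).1.mul
      (hF.hasFDerivAt_trilin (Γ := Γ) hy (hd y hy) i j k).1
  rw [h2, h3.fderiv_eq, fderiv_const_mul hpd, h1 y hy, nablaSq, pairing_sub_left, smul_apply,
    hF.fderiv_pairing h hVU hy (hnd y hy X) (hd y hy), smul_eq_mul]
  ring

end IsFrameOn

end LocalBochner

/-! ### Conjugate symmetry and the Bochner term -/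

section ConjugateSymmetry

set_option synthInstance.maxHeartbeats 200000

open Filter Topology

variable {E : Type*} [NormedAddCommGroup E] [NormedSpace ℝ E]

/-- A smooth field of symmetric trilinear forms on an open set. -/
structure IsCubicOn (a : E → E →L[ℝ] E →L[ℝ] E →L[ℝ] ℝ) (U : Set E) : Prop where
  isOpen : IsOpen U
  contDiffOn : ContDiffOn ℝ ∞ a U
  swap_left : ∀ y ∈ U, ∀ u v w, a y u v w = a y v u w
  swap_right : ∀ y ∈ U, ∀ u v w, a y u v w = a y u w v

variable {g : E → E →L[ℝ] E →L[ℝ] ℝ} {Γ : E → E →L[ℝ] E →L[ℝ] E} {U : Set E}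
  {a : E → E →L[ℝ] E →L[ℝ] E →L[ℝ] ℝ}

namespace IsCubicOn

lemma differentiableAt (ha : IsCubicOn a U) {y : E} (hy : y ∈ U) : DifferentiableAt ℝ a y :=
  (ha.contDiffOn.contDiffAt (ha.isOpen.mem_nhds hy)).differentiableAt (by simp)

lemma fderiv_swap_left (ha : IsCubicOn a U) {y : E} (hy : y ∈ U) (X u v w : E) :
    fderiv ℝ a y X u v w = fderiv ℝ a y X v u w := by
  rw [← fderiv_trilin_apply (ha.differentiableAt hy),
    ← fderiv_trilin_apply (ha.differentiableAt hy)]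
  have : (fun z => a z u v w) =ᶠ[𝓝 y] fun z => a z v u w := by
    filter_upwards [ha.isOpen.mem_nhds hy] with z hz using ha.swap_left z hz u v w
  rw [this.fderiv_eq]

lemma fderiv_swap_right (ha : IsCubicOn a U) {y : E} (hy : y ∈ U) (X u v w : E) :
    fderiv ℝ a y X u v w = fderiv ℝ a y X u w v := by
  rw [← fderiv_trilin_apply (ha.differentiableAt hy),
    ← fderiv_trilin_apply (ha.differentiableAt hy)]
  have : (fun z => a z u v w) =ᶠ[𝓝 y] fun z => a z u w v := by
    filter_upwards [ha.isOpen.mem_nhds hy] with z hz using ha.swap_right z hz u v w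
  rw [this.fderiv_eq]

/-- The covariant derivatives of a symmetric trilinear form are symmetric. -/
lemma nabla [FiniteDimensional ℝ E] (ha : IsCubicOn a U) (hΓ : ContDiffOn ℝ ∞ Γ U) (X : E) :
    IsCubicOn (fun y => nabla Γ a y X) U := by
  refine ⟨ha.isOpen, contDiffOn_nabla ha.isOpen hΓ ha.contDiffOn X, ?_, ?_⟩
  · intro y hy u v w
    rw [nabla_apply, nabla_apply, ha.fderiv_swap_left hy, ha.swap_left y hy (Γ y X u),
      ha.swap_left y hy u, ha.swap_left y hy u v]
    ring
  · intro y hy u v w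
    rw [nabla_apply, nabla_apply, ha.fderiv_swap_right hy, ha.swap_right y hy (Γ y X u),
      ha.swap_right y hy u (Γ y X v), ha.swap_right y hy u v]
    ring

/-- A statistical structure is conjugate symmetric only if the covariant derivative of its cubic
form is totally symmetric. -/
lemma nabla_swap (ha : IsCubicOn a U) (h : IsLeviCivitaOn g Γ U) {K : E → E →L[ℝ] E →L[ℝ] E}
    (hK : ContDiffOn ℝ ∞ K U) (hKa : ∀ y ∈ U, ∀ u v w, g y (K y u v) w = a y u v w) {y : E}
    (hy : y ∈ U) (hconj : ∀ u v w z, g y (curv (fun y => Γ y + K y) y u v w) z =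
      - g y (curv (fun y => Γ y + K y) y u v z) w) (u v w z : E) :
    Statistical.nabla Γ a y u v w z = Statistical.nabla Γ a y v u w z := by
  have hΓd := h.differentiableAt_conn hy
  have hKd : DifferentiableAt ℝ K y :=
    (hK.contDiffAt (h.mem_nhds hy)).differentiableAt (by simp)
  have hgd := h.differentiableAt hy
  -- Differentiating `g(K(v, w), z) = a(v, w, z)` and using compatibility.
  have hDK : ∀ u v w z, g y (fderiv ℝ K y u v w) z = fderiv ℝ a y u v w z -
      g y (Γ y u (K y v w)) z - a y v w (Γ y u z) := by
    intro u v w z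
    have hev : (fun x => a x v w z) =ᶠ[𝓝 y] fun x => g x (K x v w) z := by
      filter_upwards [h.mem_nhds hy] with x hx using (hKa x hx v w z).symm
    have hK' : HasFDerivAt (fun x => K x v w) (((fderiv ℝ K y).flip v).flip w) y := by
      refine ((hKd.hasFDerivAt.clm_apply (hasFDerivAt_const v y)).clm_apply
        (hasFDerivAt_const w y)).congr_fderiv (ContinuousLinearMap.ext fun u => ?_)
      simp
    have h1 := (hgd.hasFDerivAt.clm_apply hK').clm_apply (hasFDerivAt_const z y)
    rw [← fderiv_trilin_apply (ha.differentiableAt hy), hev.fderiv_eq, h1.fderiv, ← hKa y hy]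
    simp only [add_apply, ContinuousLinearMap.comp_apply, ContinuousLinearMap.flip_apply,
      zero_apply, h.compat y hy, map_zero]
    ring
  have hsum : fderiv ℝ (fun y => Γ y + K y) y = fderiv ℝ Γ y + fderiv ℝ K y :=
    fderiv_fun_add hΓd hKd
  -- The first and last summands are skew in `w`, `z` and the middle one is symmetric, so conjugate
  -- symmetry forces the middle one to vanish.
  have hcurv : ∀ w z, g y (curv (fun y => Γ y + K y) y u v w) z =
      g y (curv Γ y u v w) z + (Statistical.nabla Γ a y u v w z -
        Statistical.nabla Γ a y v u w z) +
      (g y (K y u z) (K y v w) - g y (K y v z) (K y u w)) := by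
    intro w z
    have e1 : g y (K y u (K y v w)) z = g y (K y u z) (K y v w) := by
      rw [hKa y hy, hKa y hy, ha.swap_right y hy]
    have e2 : g y (K y v (K y u w)) z = g y (K y v z) (K y u w) := by
      rw [hKa y hy, hKa y hy, ha.swap_right y hy]
    simp only [curv, hsum, nabla_apply, map_add, map_sub, add_apply, sub_apply, hDK,
      h.conn_symm y hy v u, hKa y hy u (Γ y v w), hKa y hy v (Γ y u w), e1, e2]
    rw [← sub_eq_zero]
    ring
  have c1 := hconj u v w z
  rw [hcurv, hcurv, h.inner_curv_swap hy u v w z] at c1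
  have k1 := h.symm y hy (K y u z) (K y v w)
  have k2 := h.symm y hy (K y v z) (K y u w)
  have s1 : ∀ X Y, Statistical.nabla Γ a y X Y w z = Statistical.nabla Γ a y X Y z w := by
    intro X Y
    rw [nabla_apply, nabla_apply, ha.fderiv_swap_right hy, ha.swap_right y hy (Γ y X Y),
      ha.swap_right y hy Y (Γ y X w), ha.swap_right y hy Y w]
    ring
  rw [s1 u v, s1 v u] at c1 ⊢
  linarith

end IsCubicOn

/-- The curvature tensor as a continuous trilinear map. -/
noncomputable def curvL (Γ : E → E →L[ℝ] E →L[ℝ] E) (y : E) : E →L[ℝ] E →L[ℝ] E →L[ℝ] E :=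
  fderiv ℝ Γ y - (fderiv ℝ Γ y).flip +
    (((ContinuousLinearMap.compL ℝ E E E ∘L Γ y).flip ∘L Γ y).flip -
      (ContinuousLinearMap.compL ℝ E E E ∘L Γ y).flip ∘L Γ y)

lemma curvL_apply (Γ : E → E →L[ℝ] E →L[ℝ] E) (y u v w : E) :
    curvL Γ y u v w = curv Γ y u v w := by
  simp [curvL, curv]
  abel

/-- The sectional curvature form is determined by its values on orthonormal pairs. -/
lemma IsLeviCivitaOn.inner_curv_cases (h : IsLeviCivitaOn g Γ U) {y : E} (hy : y ∈ U) (u v : E) :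
    (g y (curv Γ y u v v) u = 0 ∧ (∃ c : ℝ, u = c • v ∨ v = 0)) ∨
    ∃ (c : ℝ) (u' v' : E), 0 < c ∧ g y u' u' = 1 ∧ g y v' v' = 1 ∧ g y u' v' = 0 ∧
      g y (curv Γ y u v v) u = c * g y (curv Γ y u' v' v') u' := by
  by_cases hv : v = 0
  · left
    refine ⟨?_, 0, Or.inr hv⟩
    rw [hv, ← curvL_apply]; simp
  have hvv := h.pos y hy v hv
  -- By the skew-symmetries of the curvature only the part of `u` orthogonal to `v` matters;
  -- rescaling it and `v` to unit length produces the factor `c`.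
  set u₁ := u - (g y u v / g y v v) • v with hu₁
  have hperp : g y u₁ v = 0 := by
    simp only [hu₁, map_sub, map_smul, sub_apply, smul_apply, smul_eq_mul]
    field_simp
    ring
  have hu : u = u₁ + (g y u v / g y v v) • v := by rw [hu₁]; abel
  have hself : ∀ w, curv Γ y v v w = 0 := fun w => by
    simp only [curv]; abel
  have hRm : g y (curv Γ y u v v) u = g y (curv Γ y u₁ v v) u₁ := by
    have e1 : curv Γ y u v v = curv Γ y u₁ v v := by
      conv_lhs => rw [hu]
      rw [curv_add_left, curv_smul_left, hself, smul_zero, add_zero]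
    have e2 : g y (curv Γ y u₁ v v) v = 0 := by
      have := h.inner_curv_swap hy u₁ v v v
      linarith
    rw [e1]
    conv_lhs => rw [hu]
    rw [map_add, map_smul, e2, smul_zero, add_zero]
  by_cases hu0 : u₁ = 0
  · left
    refine ⟨?_, g y u v / g y v v, Or.inl ?_⟩
    · rw [hRm, hu0]; simp
    · rw [hu0, zero_add] at hu; exact hu
  right
  have huu := h.pos y hy u₁ hu0
  set p := √(g y u₁ u₁) with hp
  set q := √(g y v v) with hq
  have hp0 : 0 < p := Real.sqrt_pos.2 huu
  have hq0 : 0 < q := Real.sqrt_pos.2 hvv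
  have hp2 : p * p = g y u₁ u₁ := Real.mul_self_sqrt huu.le
  have hq2 : q * q = g y v v := Real.mul_self_sqrt hvv.le
  refine ⟨(p * p) * (q * q), p⁻¹ • u₁, q⁻¹ • v, by positivity, ?_, ?_, ?_, ?_⟩
  · simp only [map_smul, smul_apply, smul_eq_mul, ← hp2]
    field_simp
  · simp only [map_smul, smul_apply, smul_eq_mul, ← hq2]
    field_simp
  · simp [hperp]
  · rw [hRm]
    simp only [← curvL_apply, map_smul, smul_apply, smul_eq_mul]
    field_simp

lemma sum_inner_curv {ι : Type*} [Fintype ι] (y : E) (F : ι → E) (η ξ : ι → ℝ) :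
    ∑ l, ∑ m, ∑ p, ∑ q, g y (curv Γ y (F l) (F p) (F q)) (F m) * η l * ξ p * ξ q * η m =
      g y (curv Γ y (∑ l, η l • F l) (∑ p, ξ p • F p) (∑ q, ξ q • F q)) (∑ m, η m • F m) := by
  simp only [← curvL_apply]
  have s1 : ∀ v w z, g y (curvL Γ y (∑ l, η l • F l) v w) z =
      ∑ l, η l * g y (curvL Γ y (F l) v w) z := by
    intro v w z; simp [map_sum, sum_apply]
  have s2 : ∀ u w z, g y (curvL Γ y u (∑ l, ξ l • F l) w) z =
      ∑ l, ξ l * g y (curvL Γ y u (F l) w) z := by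
    intro v w z; simp [map_sum, sum_apply]
  have s3 : ∀ u v z, g y (curvL Γ y u v (∑ l, ξ l • F l)) z =
      ∑ l, ξ l * g y (curvL Γ y u v (F l)) z := by
    intro v w z; simp [map_sum, sum_apply]
  have s4 : ∀ u v w, g y (curvL Γ y u v w) (∑ l, η l • F l) =
      ∑ l, η l * g y (curvL Γ y u v w) (F l) := by
    intro v w z; simp [map_sum]
  rw [s1]
  refine Finset.sum_congr rfl fun l _ => ?_
  rw [s4, Finset.mul_sum]
  refine Finset.sum_congr rfl fun m _ => ?_
  rw [s2, Finset.mul_sum, Finset.mul_sum]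
  refine Finset.sum_congr rfl fun p _ => ?_
  rw [s3, Finset.mul_sum, Finset.mul_sum, Finset.mul_sum]
  exact Finset.sum_congr rfl fun q _ => by ring

end ConjugateSymmetry

/-! ### Components of a conjugate symmetric structure in an orthonormal frame -/

section BochnerTerm

set_option synthInstance.maxHeartbeats 200000

open Filter Topology

variable {E : Type*} [NormedAddCommGroup E] [NormedSpace ℝ E] [FiniteDimensional ℝ E]
  {g : E → E →L[ℝ] E →L[ℝ] ℝ} {Γ : E → E →L[ℝ] E →L[ℝ] E} {U : Set E}
  {a : E → E →L[ℝ] E →L[ℝ] E →L[ℝ] ℝ} {ι : Type*} [Fintype ι] [DecidableEq ι]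

/-- The components in an orthonormal frame of a cubic form with totally symmetric covariant
derivative and parallel derivative of the trace. -/
lemma bochnerArrays (h : IsLeviCivitaOn g Γ U) (ha : IsCubicOn a U)
    (hsymm : ∀ y ∈ U, ∀ u v w z, nabla Γ a y u v w z = nabla Γ a y v u w z) {y : E} (hy : y ∈ U)
    {F : ι → E} (hF : IsOrthoFrame (g y) F)
    (htr : ∀ X Y w, ∑ l, nablaSq Γ a y X Y (F l) (F l) w = 0) :
    BochnerArrays (fun i j k => a y (F i) (F j) (F k))
      (fun i j k l => g y (curv Γ y (F i) (F j) (F k)) (F l))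
      (fun i j k l m => nablaSq Γ a y (F i) (F j) (F k) (F l) (F m)) where
  A_left i j k := ha.swap_left y hy _ _ _
  A_right i j k := ha.swap_right y hy _ _ _
  R_left i j k l := by rw [curv_swap]; simp
  R_right i j k l := h.inner_curv_swap hy _ _ _ _
  D_left i j k l m := by
    have hn := fun X => (ha.nabla h.contDiffOn_conn X).differentiableAt hy
    simp only [nablaSq, sub_apply]
    rw [nabla_apply Γ (fun z => nabla Γ a z _), nabla_apply Γ (fun z => nabla Γ a z _),
      ← fderiv_trilin_apply (hn _), ← fderiv_trilin_apply (hn _)]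
    -- Total symmetry of the first derivative holds on an open set, so it may be differentiated.
    have hev : (fun z => nabla Γ a z (F j) (F k) (F l) (F m)) =ᶠ[𝓝 y]
        fun z => nabla Γ a z (F k) (F j) (F l) (F m) := by
      filter_upwards [h.mem_nhds hy] with z hz using hsymm z hz _ _ _ _
    rw [hev.fderiv_eq, hsymm y hy (F j) (Γ y (F i) (F k)), hsymm y hy (F j) (F k),
      hsymm y hy (F j) (F k), hsymm y hy (Γ y (F i) (F j)) (F k)]
    ring
  D_mid i j k l m := by
    simp only [nablaSq, sub_apply]
    rw [((ha.nabla h.contDiffOn_conn (F j)).nabla h.contDiffOn_conn (F i)).swap_left y hy,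
      (ha.nabla h.contDiffOn_conn _).swap_left y hy]
  ricci i j k l m := by
    rw [nablaSq_sub_nablaSq h.isOpen h.contDiffOn_conn ha.contDiffOn hy (h.conn_symm y hy)]
    conv_lhs => rw [hF.expand (curv Γ y (F i) (F j) (F k)), hF.expand (curv Γ y (F i) (F j) (F l)),
      hF.expand (curv Γ y (F i) (F j) (F m))]
    simp only [map_sum, map_smul, sum_apply, smul_apply, smul_eq_mul, Finset.sum_add_distrib]
  trace i j m := htr _ _ _

end BochnerTerm

/-! ### The maximum principle for the squared norm of a cubic form -/

section CovDeriv

set_option synthInstance.maxHeartbeats 200000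

open Filter Topology

variable {E : Type*} [NormedAddCommGroup E] [NormedSpace ℝ E]

lemma covDeriv_trilin (Γ : E → E →L[ℝ] E →L[ℝ] E) {a : E → E →L[ℝ] E →L[ℝ] E →L[ℝ] ℝ} {y : E}
    (ha : DifferentiableAt ℝ a y) (v : Fin 4 → E) :
    covDeriv (fun y u v => Γ y u v) (fun y (v : Fin 3 → E) => a y (v 0) (v 1) (v 2)) y v =
      nabla Γ a y (v 0) (v 1) (v 2) (v 3) := by
  rw [nabla_apply, covDeriv, fderiv_trilin_apply ha]
  simp [Fin.sum_univ_three, Fin.tail, Function.update]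

variable {ι : Type*} [Fintype ι] [DecidableEq ι] {g : E → E →L[ℝ] E →L[ℝ] ℝ}
  {Γ : E → E →L[ℝ] E →L[ℝ] E} {U V : Set E} {F : ι → E → E}
  {a : E → E →L[ℝ] E →L[ℝ] E →L[ℝ] ℝ}

/-- A metric connection commutes with traces. Applied twice, this expresses the second covariant
derivative of `τ` through that of the cubic form. -/
lemma IsFrameOn.covDeriv_trace (hF : IsFrameOn g F V) (h : IsLeviCivitaOn g Γ U) (hVU : V ⊆ U)
    {y : E} (hy : y ∈ V) (ha : DifferentiableAt ℝ a y) {t : E → (Fin 1 → E) → ℝ}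
    (ht : ∀ z ∈ V, ∀ v, t z v = ∑ i, a z (F i z) (F i z) (v 0)) (v : Fin 2 → E) :
    covDeriv (fun y u v => Γ y u v) t y v = ∑ i, nabla Γ a y (v 0) (F i y) (F i y) (v 1) := by
  have hev : (fun z => t z (Fin.tail v)) =ᶠ[𝓝 y] fun z => ∑ i, a z (F i z) (F i z) (v 1) := by
    filter_upwards [hF.isOpen.mem_nhds hy] with z hz using ht z hz _
  rw [covDeriv, hev.fderiv_eq, hF.fderiv_trace h hVU hy ha]
  simp [ht y hy, Fin.tail]

lemma IsFrameOn.covDeriv_covDeriv_trace [FiniteDimensional ℝ E] (hF : IsFrameOn g F V)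
    (h : IsLeviCivitaOn g Γ U) (hVU : V ⊆ U) {y : E} (hy : y ∈ V) (ha : IsCubicOn a U)
    {t : E → (Fin 1 → E) → ℝ} (ht : ∀ z ∈ V, ∀ v, t z v = ∑ i, a z (F i z) (F i z) (v 0))
    (v : Fin 3 → E) :
    covDeriv (fun y u v => Γ y u v) (covDeriv (fun y u v => Γ y u v) t) y v =
      ∑ i, nablaSq Γ a y (v 0) (v 1) (F i y) (F i y) (v 2) := by
  have h1 : ∀ z ∈ V, ∀ w : Fin 2 → E, covDeriv (fun y u v => Γ y u v) t z w =
      ∑ i, nabla Γ a z (w 0) (F i z) (F i z) (w 1) := fun z hz w =>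
    hF.covDeriv_trace h hVU hz (ha.differentiableAt (hVU hz)) ht w
  have hev : (fun z => covDeriv (fun y u v => Γ y u v) t z (Fin.tail v)) =ᶠ[𝓝 y]
      fun z => ∑ i, nabla Γ a z (v 1) (F i z) (F i z) (v 2) := by
    filter_upwards [hF.isOpen.mem_nhds hy] with z hz using h1 z hz _
  rw [covDeriv, hev.fderiv_eq, hF.fderiv_trace h hVU hy
    ((ha.nabla h.contDiffOn_conn (v 1)).differentiableAt (hVU hy))]
  simp [h1 y hy, Fin.tail, Fin.sum_univ_two, nablaSq, Finset.sum_sub_distrib, Function.update]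

end CovDeriv

/-! ### Bochner's formula and the strong maximum principle in a chart -/

section LocalMaximumPrinciple

set_option synthInstance.maxHeartbeats 200000

open Filter Topology

/-- The data in a chart of a conjugate symmetric statistical structure of nonnegative sectional
curvature such that the second covariant derivative of its Czebyshev form vanishes; `φ` is the
squared norm of the cubic form. -/
structure IsBochnerDatum {E : Type*} [NormedAddCommGroup E] [NormedSpace ℝ E]
    (g : E → E →L[ℝ] E →L[ℝ] ℝ) (Γ : E → E →L[ℝ] E →L[ℝ] E)
    (a : E → E →L[ℝ] E →L[ℝ] E →L[ℝ] ℝ) (φ : E → ℝ) (U : Set E) : Prop where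
  lc : IsLeviCivitaOn g Γ U
  cubic : IsCubicOn a U
  nabla_swap : ∀ y ∈ U, ∀ u v w z, nabla Γ a y u v w z = nabla Γ a y v u w z
  trace : ∀ y ∈ U, ∀ F : Fin (Module.finrank ℝ E) → E, IsOrthoFrame (g y) F →
    ∀ X Y w, ∑ l, nablaSq Γ a y X Y (F l) (F l) w = 0
  sec : ∀ y ∈ U, ∀ u v, g y u u = 1 → g y v v = 1 → g y u v = 0 → 0 ≤ g y (curv Γ y u v v) u
  normSq : ∀ y ∈ U, ∀ F : Fin (Module.finrank ℝ E) → E, IsOrthoFrame (g y) F →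
    φ y = pairing (a y) (a y) F

namespace IsBochnerDatum

variable {E : Type*} [NormedAddCommGroup E] [NormedSpace ℝ E] [FiniteDimensional ℝ E]
  {g : E → E →L[ℝ] E →L[ℝ] ℝ} {Γ : E → E →L[ℝ] E →L[ℝ] E}
  {a : E → E →L[ℝ] E →L[ℝ] E →L[ℝ] ℝ} {φ : E → ℝ} {U V : Set E}
  {F : Fin (Module.finrank ℝ E) → E → E}

lemma arrays (H : IsBochnerDatum g Γ a φ U) (hF : IsFrameOn g F V) (hVU : V ⊆ U) {y : E}
    (hy : y ∈ V) :
    BochnerArrays (fun i j k => a y (F i y) (F j y) (F k y))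
      (fun i j k l => g y (curv Γ y (F i y) (F j y) (F k y)) (F l y))
      (fun i j k l m => nablaSq Γ a y (F i y) (F j y) (F k y) (F l y) (F m y)) :=
  bochnerArrays H.lc H.cubic H.nabla_swap (hVU hy) (hF.orthoFrame y hy)
    (H.trace y (hVU hy) _ (hF.orthoFrame y hy))

omit [FiniteDimensional ℝ E] in
lemma inner_curv_nonneg (H : IsBochnerDatum g Γ a φ U) {y : E} (hy : y ∈ U) (u v : E) :
    0 ≤ g y (curv Γ y u v v) u := by
  rcases H.lc.inner_curv_cases hy u v with h | ⟨c, u', v', hc, hu, hv, huv, h⟩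
  · exact h.1.ge
  · rw [h]
    exact mul_nonneg hc.le (H.sec y hy u' v' hu hv huv)

omit [FiniteDimensional ℝ E] in
lemma sum_inner_curv_nonneg (H : IsBochnerDatum g Γ a φ U) {y : E} (hy : y ∈ U)
    {ι : Type*} [Fintype ι] (F : ι → E) (η ξ : ι → ℝ) :
    0 ≤ ∑ l, ∑ m, ∑ p, ∑ q, g y (curv Γ y (F l) (F p) (F q)) (F m) * η l * ξ p * ξ q * η m := by
  rw [sum_inner_curv]
  exact H.inner_curv_nonneg hy _ _

/-- The Bochner term of the cubic form. -/
lemma bochner_nonneg (H : IsBochnerDatum g Γ a φ U) (hF : IsFrameOn g F V) (hVU : V ⊆ U) {y : E}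
    (hy : y ∈ V) :
    0 ≤ ∑ l, pairing (nablaSq Γ a y (F l y) (F l y)) (a y) (fun i => F i y) :=
  (H.arrays hF hVU hy).sum_nonneg (H.sum_inner_curv_nonneg (hVU hy) _)

lemma contDiffAt (H : IsBochnerDatum g Γ a φ U) {y : E} (hy : y ∈ U) : ContDiffAt ℝ 2 φ y := by
  obtain ⟨V, hVU, hyV, F, hF⟩ := exists_isFrameOn H.lc.toIsMetricOn hy
  exact (hF.fderiv_fderiv_normSq H.lc hVU H.cubic.contDiffOn
    (fun z hz => H.normSq z (hVU hz) _ (hF.orthoFrame z hz)) hyV 0).1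

/-- The drift vector completes the second derivatives along the frame to the Laplace–Beltrami
operator; the identity is the sum of Bochner's formula over the frame. -/
lemma laplacian (H : IsBochnerDatum g Γ a φ U) (hF : IsFrameOn g F V) (hVU : V ⊆ U) {y : E}
    (hy : y ∈ V) :
    ∑ l, fderiv ℝ (fderiv ℝ φ) y (F l y) (F l y) + fderiv ℝ φ y (- ∑ l, Γ y (F l y) (F l y)) =
      2 * ∑ l, pairing (nablaSq Γ a y (F l y) (F l y)) (a y) (fun i => F i y) +
      2 * ∑ l, pairing (nabla Γ a y (F l y)) (nabla Γ a y (F l y)) (fun i => F i y) := by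
  rw [map_neg, map_sum, ← sub_eq_add_neg, ← Finset.sum_sub_distrib, Finset.mul_sum, Finset.mul_sum,
    ← Finset.sum_add_distrib]
  exact Finset.sum_congr rfl fun l _ => (hF.fderiv_fderiv_normSq H.lc hVU H.cubic.contDiffOn
    (fun z hz => H.normSq z (hVU hz) _ (hF.orthoFrame z hz)) hy (F l y)).2

omit [FiniteDimensional ℝ E] in
lemma sum_pairing_nabla_nonneg (Γ : E → E →L[ℝ] E →L[ℝ] E) (a : E → E →L[ℝ] E →L[ℝ] E →L[ℝ] ℝ)
    (F : Fin (Module.finrank ℝ E) → E → E) (y : E) :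
    0 ≤ ∑ l, pairing (nabla Γ a y (F l y)) (nabla Γ a y (F l y)) (fun i => F i y) :=
  Finset.sum_nonneg fun _ _ => pairing_self_nonneg _ _

/-- For locally constant `φ` the Laplacian is zero, and it is twice the sum of two nonnegative
terms. -/
lemma terms_eq_zero (H : IsBochnerDatum g Γ a φ U) (hF : IsFrameOn g F V) (hVU : V ⊆ U) {y : E}
    (hy : y ∈ V) (hφ : ∀ᶠ z in 𝓝 y, φ z = φ y) :
    ∑ l, pairing (nablaSq Γ a y (F l y) (F l y)) (a y) (fun i => F i y) = 0 ∧
    ∑ l, pairing (nabla Γ a y (F l y)) (nabla Γ a y (F l y)) (fun i => F i y) = 0 := by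
  have hev : φ =ᶠ[𝓝 y] fun _ => φ y := hφ
  have h1 : fderiv ℝ φ =ᶠ[𝓝 y] fun _ => 0 := by
    filter_upwards [hev.eventuallyEq_nhds] with z hz
    rw [hz.fderiv_eq]; simp
  have h2 : fderiv ℝ (fderiv ℝ φ) y = 0 := by rw [h1.fderiv_eq]; simp
  have hL := H.laplacian hF hVU hy
  rw [h2, h1.eq_of_nhds] at hL
  simp only [zero_apply, Finset.sum_const_zero, add_zero] at hL
  have n1 := H.bochner_nonneg hF hVU hy
  have n2 := sum_pairing_nabla_nonneg Γ a F y
  constructor <;> linarith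

/-- If the norm of the cubic form is locally constant, then the cubic form is parallel. -/
lemma nabla_eq_zero (H : IsBochnerDatum g Γ a φ U) {y : E} (hy : y ∈ U)
    (hφ : ∀ᶠ z in 𝓝 y, φ z = φ y) (X u v w : E) : nabla Γ a y X u v w = 0 := by
  obtain ⟨V, hVU, hyV, F, hF⟩ := exists_isFrameOn H.lc.toIsMetricOn hy
  have h0 := (H.terms_eq_zero hF hVU hyV hφ).2
  have hO := hF.orthoFrame y hyV
  have h1 : ∀ l u v w, nabla Γ a y (F l y) u v w = 0 := fun l =>
    eq_zero_of_pairing_self_eq_zero hO ((Finset.sum_eq_zero_iff_of_nonneg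
      fun _ _ => pairing_self_nonneg _ _).1 h0 l (Finset.mem_univ _))
  have hlin : nabla Γ a y X u v w = ∑ l, g y X (F l y) * nabla Γ a y (F l y) u v w := by
    conv_lhs => rw [hO.expand X]
    simp only [nabla_apply, map_sum, map_smul, sum_apply, smul_apply, smul_eq_mul,
      ← Finset.sum_add_distrib, ← Finset.sum_sub_distrib]
    exact Finset.sum_congr rfl fun l _ => by ring
  simp [hlin, h1]

/-- If the norm of the cubic form is locally constant near a point with positive sectional
curvature, then the cubic form vanishes there. -/
lemma eq_zero_of_sec_pos (H : IsBochnerDatum g Γ a φ U) {y : E} (hy : y ∈ U)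
    (hφ : ∀ᶠ z in 𝓝 y, φ z = φ y) (hdim : 2 ≤ Module.finrank ℝ E)
    (hpos : ∀ u v, g y u u = 1 → g y v v = 1 → g y u v = 0 → 0 < g y (curv Γ y u v v) u)
    (u v w : E) : a y u v w = 0 := by
  obtain ⟨V, hVU, hyV, F, hF⟩ := exists_isFrameOn H.lc.toIsMetricOn hy
  have h0 := (H.terms_eq_zero hF hVU hyV hφ).1
  have hO := hF.orthoFrame y hyV
  have : Nontrivial (Fin (Module.finrank ℝ E)) := Fin.nontrivial_iff_two_le.2 hdim
  have hA := (H.arrays hF hVU hyV).eq_zero_of_sum_eq_zero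
    (H.sum_inner_curv_nonneg hy fun i => F i y) (fun η ξ hz i j => ?_) h0
  · refine eq_zero_of_pairing_self_eq_zero hO ?_ u v w
    simp [pairing, hA]
  · rw [sum_inner_curv (F := fun i => F i y)] at hz
    have hcoord : ∀ (c : Fin (Module.finrank ℝ E) → ℝ) i, g y (∑ l, c l • F l y) (F i y) = c i := by
      intro c i
      simp [map_sum, sum_apply, hO.orth]
    -- Either the two vectors are dependent, as required, or the curvature term is a positive
    -- multiple of a positive sectional curvature and cannot vanish.
    rcases H.lc.inner_curv_cases hy (∑ l, η l • F l y) (∑ l, ξ l • F l y) with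
      ⟨-, c, h | h⟩ | ⟨c, u', v', hc, hu, hv, huv, h⟩
    · have hη : ∀ i, η i = c * ξ i := fun i => by
        rw [← hcoord η i, h, map_smul, smul_apply, hcoord, smul_eq_mul]
      rw [hη, hη]; ring
    · have hξ : ∀ i, ξ i = 0 := fun i => by
        rw [← hcoord ξ i, h]; simp
      rw [hξ, hξ]; ring
    · rw [h] at hz
      exact absurd hz (mul_pos hc (hpos u' v' hu hv huv)).ne'

end IsBochnerDatum

/-- The strong maximum principle for the norm of the cubic form. -/
theorem IsBochnerDatum.eventually_eq_of_isLocalMax {E : Type*} [NormedAddCommGroup E]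
    [InnerProductSpace ℝ E] [FiniteDimensional ℝ E]
    {g : E → E →L[ℝ] E →L[ℝ] ℝ} {Γ : E → E →L[ℝ] E →L[ℝ] E}
    {a : E → E →L[ℝ] E →L[ℝ] E →L[ℝ] ℝ} {φ : E → ℝ} {U : Set E}
    (H : IsBochnerDatum g Γ a φ U) {y₀ : E} (hy₀ : y₀ ∈ U) (hmax : ∀ᶠ y in 𝓝 y₀, φ y ≤ φ y₀) :
    ∀ᶠ y in 𝓝 y₀, φ y = φ y₀ := by
  obtain ⟨V, hVU, hyV, F, hF⟩ := exists_isFrameOn H.lc.toIsMetricOn hy₀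
  have hVn := hF.isOpen.mem_nhds hyV
  have hFc : ∀ i, ContinuousAt (F i) y₀ := fun i => (hF.differentiableAt hyV i).continuousAt
  have hbdd : ∀ {G : Type _} [SeminormedAddCommGroup G] {f : E → G}, ContinuousAt f y₀ →
      ∀ᶠ y in 𝓝 y₀, ‖f y‖ ≤ ‖f y₀‖ + 1 := fun hf =>
    (hf.norm.eventually (gt_mem_nhds (lt_add_one _))).mono fun _ h => h.le
  have hbc : ContinuousAt (fun y => - ∑ l, Γ y (F l y) (F l y)) y₀ := by
    have hΓ := (H.lc.differentiableAt_conn hy₀).continuousAt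
    exact (tendsto_finsetSum _ fun l _ =>
      ((hΓ.clm_apply (hFc l)).clm_apply (hFc l))).neg
  set b₀ := ‖- ∑ l, Γ y₀ (F l y₀) (F l y₀)‖ + 1 with hb₀
  set B := ∑ i, (‖F i y₀‖ + 1) with hB
  set G := ‖g y₀‖ + 1 with hG
  have hG0 : 0 < G := by positivity
  have hFb : ∀ᶠ y in 𝓝 y₀, ∀ i, ‖F i y‖ ≤ B := by
    refine eventually_all.2 fun i => (hbdd (hFc i)).mono fun y hy => hy.trans ?_
    exact Finset.single_le_sum (f := fun i => ‖F i y₀‖ + 1) (fun i _ => by positivity)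
      (Finset.mem_univ i)
  have hB0 : 0 ≤ B := Finset.sum_nonneg fun i _ => by positivity
  -- Ellipticity constant for a `g`-orthonormal frame measured in the Euclidean product: expanding
  -- `w` gives `‖w‖² = ∑ g(w, F_i)⟨w, F_i⟩`, and Cauchy–Schwarz with `|g(w, F_i)| ≤ G B ‖w‖` bounds
  -- `‖w‖²` by `N ∑ ⟨w, F_i⟩²`. The `+ 1` ensures `N > 0`.
  set N : ℝ := (Module.finrank ℝ E : ℝ) * (G * B) ^ 2 + 1 with hN
  have hN0 : 0 < N := by positivity
  refine eventually_eq_of_isLocalMax_of_subsolution (ι := Fin (Module.finrank ℝ E)) (κ := N⁻¹)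
    (Λ := max B b₀) (by positivity) ?_ hmax ?_
  · filter_upwards [hVn] with y hy using H.contDiffAt (hVU hy)
  · filter_upwards [hVn, hFb, hbdd hbc, hbdd (H.lc.differentiableAt hy₀).continuousAt]
      with y hy h1 h2 h3
    have hO := hF.orthoFrame y hy
    refine ⟨fun i => F i y, _, h2.trans (le_max_right _ _), fun i => (h1 i).trans (le_max_left _ _),
      fun w => ?_, ?_⟩
    · rw [inv_mul_le_iff₀ hN0]
      by_cases hw : w = 0
      · subst hw; simp
      have hw0 : 0 < ‖w‖ := norm_pos_iff.2 hw
      have e1 : ‖w‖ ^ 2 = ∑ i, g y w (F i y) * inner ℝ w (F i y) := by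
        rw [← real_inner_self_eq_norm_sq]
        conv_lhs => rw [hO.expand w, inner_sum]
        rw [← hO.expand w]
        exact Finset.sum_congr rfl fun i _ => by rw [real_inner_smul_right]
      have e2 := Finset.sum_mul_sq_le_sq_mul_sq Finset.univ (fun i => g y w (F i y))
        (fun i => inner ℝ w (F i y))
      rw [← e1] at e2
      have e3 : ∑ i, g y w (F i y) ^ 2 ≤ (Module.finrank ℝ E : ℝ) * (G * B) ^ 2 * ‖w‖ ^ 2 := by
        have : ∀ i ∈ Finset.univ, g y w (F i y) ^ 2 ≤ (G * B) ^ 2 * ‖w‖ ^ 2 := by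
          intro i _
          have k1 : ‖g y w (F i y)‖ ≤ G * ‖w‖ * B :=
            ((g y).le_opNorm₂ w (F i y)).trans (mul_le_mul (mul_le_mul_of_nonneg_right h3
              (norm_nonneg _)) (h1 i) (norm_nonneg _) (by positivity))
          rw [Real.norm_eq_abs] at k1
          rw [← sq_abs, ← mul_pow]
          refine pow_le_pow_left₀ (abs_nonneg _) (k1.trans (by linarith [mul_comm B ‖w‖])) 2
        have k2 := Finset.sum_le_card_nsmul _ _ _ this
        simp only [Finset.card_univ, Fintype.card_fin, nsmul_eq_mul] at k2
        linarith
      have hS : 0 ≤ ∑ i, inner ℝ w (F i y) ^ 2 := Finset.sum_nonneg fun i _ => sq_nonneg _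
      have e4 : (‖w‖ ^ 2) ^ 2 ≤ (N * ‖w‖ ^ 2) * ∑ i, inner ℝ w (F i y) ^ 2 := by
        refine e2.trans (mul_le_mul_of_nonneg_right (e3.trans ?_) hS)
        exact mul_le_mul_of_nonneg_right (by linarith) (by positivity)
      have hw2 : 0 < ‖w‖ ^ 2 := by positivity
      have e5 : ‖w‖ ^ 2 * ‖w‖ ^ 2 ≤ ‖w‖ ^ 2 * (N * ∑ i, inner ℝ w (F i y) ^ 2) := by
        calc _ = (‖w‖ ^ 2) ^ 2 := by ring
          _ ≤ _ := e4
          _ = _ := by ring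
      exact le_of_mul_le_mul_left e5 hw2
    · rw [H.laplacian hF hVU hy]
      have n1 := H.bochner_nonneg hF hVU hy
      have n2 := sum_pairing_nabla_nonneg Γ a F y
      linarith

end LocalMaximumPrinciple

/-! ### Statistical structures in charts -/

section Charts

set_option synthInstance.maxHeartbeats 200000

open Filter Topology

/-- The trace of an endomorphism in an orthonormal frame. -/
lemma IsOrthoFrame.trace_eq_sum {E : Type*} [NormedAddCommGroup E] [NormedSpace ℝ E]
    [FiniteDimensional ℝ E] {ι : Type*} [Fintype ι] [DecidableEq ι] {b : E →L[ℝ] E →L[ℝ] ℝ}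
    {F : ι → E} (h : IsOrthoFrame b F) (L : E →ₗ[ℝ] E) :
    LinearMap.trace ℝ E L = ∑ i, b (L (F i)) (F i) := by
  have hL : L = ∑ i, LinearMap.smulRight (b.flip (F i)).toLinearMap (L (F i)) := by
    ext v
    conv_lhs => rw [h.expand v]
    simp [map_sum]
  conv_lhs => rw [hL]
  rw [map_sum]
  refine Finset.sum_congr rfl fun i _ => ?_
  rw [LinearMap.trace_smulRight]
  simp

/-- The pullback of a trilinear form by a linear map. -/
noncomputable def pullTrilin {E : Type*} [NormedAddCommGroup E] [NormedSpace ℝ E] (c : E →L[ℝ] E)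
    (T : E →L[ℝ] E →L[ℝ] E →L[ℝ] ℝ) : E →L[ℝ] E →L[ℝ] E →L[ℝ] ℝ :=
  ContinuousLinearMap.compL ℝ E (E →L[ℝ] ℝ) (E →L[ℝ] ℝ)
      ((ContinuousLinearMap.compL ℝ E E ℝ).flip c) ∘L
    ((ContinuousLinearMap.compL ℝ E E (E →L[ℝ] ℝ)).flip c ∘L (T ∘L c))

lemma pullTrilin_apply {E : Type*} [NormedAddCommGroup E] [NormedSpace ℝ E] (c : E →L[ℝ] E)
    (T : E →L[ℝ] E →L[ℝ] E →L[ℝ] ℝ) (u v w : E) : pullTrilin c T u v w = T (c u) (c v) (c w) := by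
  simp [pullTrilin]

variable {n : ℕ} {M : Type*} [TopologicalSpace M] [ChartedSpace (EuclideanSpace ℝ (Fin n)) M]
  [IsManifold (𝓡 n) ∞ M]

/-- The differential of the inverse of a chart, as an endomorphism of the model space. -/
noncomputable def chartMap (e : OpenPartialHomeomorph M (EuclideanSpace ℝ (Fin n)))
    (y : EuclideanSpace ℝ (Fin n)) : EuclideanSpace ℝ (Fin n) →L[ℝ] EuclideanSpace ℝ (Fin n) :=
  chartVec e y

lemma isInvertible_chartMap {e : OpenPartialHomeomorph M (EuclideanSpace ℝ (Fin n))}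
    (he : e ∈ atlas (EuclideanSpace ℝ (Fin n)) M) {y : EuclideanSpace ℝ (Fin n)}
    (hy : y ∈ e.target) : (chartMap e y).IsInvertible := by
  have : IsManifold (𝓡 n) 1 M := IsManifold.of_le (n := ∞) (by simp)
  have h := (mdifferentiable_of_mem_atlas (I := 𝓡 n) he).symm
  exact ⟨h.mfderiv hy, rfl⟩

namespace StatisticalStructure

variable (S : StatisticalStructure n M)

/-- The metric at a point of the manifold, as a bilinear form on the model space. -/
noncomputable def metricAt (x : M) :
    EuclideanSpace ℝ (Fin n) →L[ℝ] EuclideanSpace ℝ (Fin n) →L[ℝ] ℝ := S.metric.inner x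

/-- The cubic form at a point of the manifold, as a trilinear form on the model space. -/
noncomputable def cubicAt (x : M) :
    EuclideanSpace ℝ (Fin n) →L[ℝ] EuclideanSpace ℝ (Fin n) →L[ℝ]
      EuclideanSpace ℝ (Fin n) →L[ℝ] ℝ := S.cubic x

/-- The cubic form in a chart. -/
noncomputable def aLoc (e : OpenPartialHomeomorph M (EuclideanSpace ℝ (Fin n)))
    (y : EuclideanSpace ℝ (Fin n)) :
    EuclideanSpace ℝ (Fin n) →L[ℝ] EuclideanSpace ℝ (Fin n) →L[ℝ]
      EuclideanSpace ℝ (Fin n) →L[ℝ] ℝ :=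
  pullTrilin (chartMap e y) (S.cubicAt (e.symm y))

variable (e : OpenPartialHomeomorph M (EuclideanSpace ℝ (Fin n)))

lemma gLoc_apply (y u v : EuclideanSpace ℝ (Fin n)) :
    S.gLoc e y u v = S.metricAt (e.symm y) (chartMap e y u) (chartMap e y v) := rfl

lemma aLoc_apply (y u v w : EuclideanSpace ℝ (Fin n)) :
    S.aLoc e y u v w =
      S.cubicAt (e.symm y) (chartMap e y u) (chartMap e y v) (chartMap e y w) :=
  pullTrilin_apply _ _ _ _ _

lemma inChart_A (y : EuclideanSpace ℝ (Fin n)) (v : Fin 3 → EuclideanSpace ℝ (Fin n)) :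
    inChart e S.A y v = S.aLoc e y (v 0) (v 1) (v 2) := by
  rw [aLoc_apply]; rfl

lemma metricAt_symm (x : M) (u v : EuclideanSpace ℝ (Fin n)) :
    S.metricAt x u v = S.metricAt x v u := S.metric.symm x u v

lemma metricAt_pos (x : M) (v : EuclideanSpace ℝ (Fin n)) (hv : v ≠ 0) :
    0 < S.metricAt x v v := S.metric.pos x v hv

variable {e}

/-- Coordinate vector fields are smooth sections, being the tangent map of the inverse chart applied
to constant sections; the metric evaluated on two of them is then smooth. -/
lemma contDiffOn_gLoc_apply (he : e ∈ atlas (EuclideanSpace ℝ (Fin n)) M)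
    (u v : EuclideanSpace ℝ (Fin n)) : ContDiffOn ℝ ∞ (fun y => S.gLoc e y u v) e.target := by
  have hsymm : ContMDiffOn (𝓡 n) (𝓡 n) ∞ e.symm e.target :=
    contMDiffOn_symm_of_mem_maximalAtlas (IsManifold.subset_maximalAtlas he)
  have hvec : ∀ w : EuclideanSpace ℝ (Fin n), ContMDiffOn (𝓡 n) (𝓡 n).tangent ∞
      (fun y => (Bundle.TotalSpace.mk' (EuclideanSpace ℝ (Fin n)) (e.symm y) (chartVec e y w) :
        TangentBundle (𝓡 n) M)) e.target := by
    intro w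
    have : IsManifold (𝓡 n) 1 M := IsManifold.of_le (n := ∞) (by simp)
    have hT := hsymm.contMDiffOn_tangentMapWithin (m := ∞) (by simp)
      e.open_target.uniqueMDiffOn
    have hconst : ContMDiffOn (𝓡 n) (𝓡 n).tangent ∞
        (fun y : EuclideanSpace ℝ (Fin n) => (⟨y, w⟩ : TangentBundle (𝓡 n) _)) e.target :=
      contMDiffOn_vectorSpace_iff_contDiffOn.2 contDiffOn_const
    refine (hT.comp hconst fun y hy => hy).congr fun y hy => ?_
    simp only [Function.comp_apply, tangentMapWithin, chartVec,
      mfderivWithin_of_isOpen e.open_target hy]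
    rfl
  have hg : ContMDiffOn (𝓡 n) ((𝓡 n).prod
      𝓘(ℝ, EuclideanSpace ℝ (Fin n) →L[ℝ] EuclideanSpace ℝ (Fin n) →L[ℝ] ℝ)) ∞
      (fun y => Bundle.TotalSpace.mk'
        (EuclideanSpace ℝ (Fin n) →L[ℝ] EuclideanSpace ℝ (Fin n) →L[ℝ] ℝ)
        (E := fun x : M => TangentSpace (𝓡 n) x →L[ℝ] TangentSpace (𝓡 n) x →L[ℝ] ℝ)
        (e.symm y) (S.metric.inner (e.symm y))) e.target :=
    S.metric.contMDiff.comp_contMDiffOn hsymm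
  have h : ContMDiffOn (𝓡 n) ((𝓡 n).prod 𝓘(ℝ)) ∞
      (fun y => Bundle.TotalSpace.mk' ℝ (E := Bundle.Trivial M ℝ) (e.symm y)
        (S.metric.inner (e.symm y) (chartVec e y u) (chartVec e y v))) e.target :=
    ContMDiffOn.clm_bundle_apply₂ (F₁ := EuclideanSpace ℝ (Fin n))
      (F₂ := EuclideanSpace ℝ (Fin n)) hg (hvec u) (hvec v)
  intro y hy
  have hy' := h y hy
  simp only [Bundle.contMDiffWithinAt_totalSpace] at hy'
  exact contMDiffWithinAt_iff_contDiffWithinAt.1 hy'.2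

lemma isMetricOn_gLoc (he : e ∈ atlas (EuclideanSpace ℝ (Fin n)) M) :
    IsMetricOn (S.gLoc e) e.target where
  isOpen := e.open_target
  contDiffOn := contDiffOn_clm_apply.2 fun u => contDiffOn_clm_apply.2 fun v =>
    S.contDiffOn_gLoc_apply he u v
  symm y _ v w := by rw [gLoc_apply, gLoc_apply, metricAt_symm]
  pos y hy v hv := by
    rw [gLoc_apply]
    refine S.metricAt_pos _ _ fun h0 => hv ?_
    exact (isInvertible_chartMap he hy).injective (h0.trans (map_zero _).symm)

lemma isCubicOn_aLoc (he : e ∈ atlas (EuclideanSpace ℝ (Fin n)) M) :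
    IsCubicOn (S.aLoc e) e.target where
  isOpen := e.open_target
  contDiffOn := contDiffOn_trilin_iff.2 fun u v w => by
    have := S.contDiffOn_cubic e he ![u, v, w]
    refine this.congr fun y _ => ?_
    rw [aLoc_apply]; rfl
  swap_left y _ u v w := by
    rw [aLoc_apply, aLoc_apply]; exact S.cubic_swap_left _ _ _ _
  swap_right y _ u v w := by
    rw [aLoc_apply, aLoc_apply]; exact S.cubic_swap_right _ _ _ _

lemma metricAt_K (x : M) (u v w : EuclideanSpace ℝ (Fin n)) :
    S.metricAt x (S.K x u v) w = S.cubicAt x u v w := by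
  have h := (isInvertible_of_pos (S.metricAt_pos x)).self_apply_inverse (S.cubicAt x u v)
  exact congrArg (fun L : EuclideanSpace ℝ (Fin n) →L[ℝ] ℝ => L w) h

lemma gLoc_KLoc (he : e ∈ atlas (EuclideanSpace ℝ (Fin n)) M) {y : EuclideanSpace ℝ (Fin n)}
    (hy : y ∈ e.target) (u v w : EuclideanSpace ℝ (Fin n)) :
    S.gLoc e y (S.KLoc e y u v) w = S.aLoc e y u v w := by
  have h : chartMap e y (S.KLoc e y u v) = S.K (e.symm y) (chartMap e y u) (chartMap e y v) :=
    (isInvertible_chartMap he hy).self_apply_inverse _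
  rw [gLoc_apply, h, metricAt_K, aLoc_apply]

lemma ΓHat_eq : S.ΓHat e = fun y u v => christoffelL (S.gLoc e) y u v := by
  funext y u v
  rw [christoffelL_apply]; rfl

/-- The difference tensor in a chart as a continuous bilinear map. -/
noncomputable def KLocL (e : OpenPartialHomeomorph M (EuclideanSpace ℝ (Fin n)))
    (y : EuclideanSpace ℝ (Fin n)) :
    EuclideanSpace ℝ (Fin n) →L[ℝ] EuclideanSpace ℝ (Fin n) →L[ℝ] EuclideanSpace ℝ (Fin n) :=
  ContinuousLinearMap.compL ℝ (EuclideanSpace ℝ (Fin n)) (EuclideanSpace ℝ (Fin n) →L[ℝ] ℝ)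
    (EuclideanSpace ℝ (Fin n)) (S.gLoc e y).inverse ∘L S.aLoc e y

lemma KLocL_apply (y a b : EuclideanSpace ℝ (Fin n)) :
    S.KLocL e y a b = (S.gLoc e y).inverse (S.aLoc e y a b) := rfl

lemma gLoc_KLocL (he : e ∈ atlas (EuclideanSpace ℝ (Fin n)) M) {y : EuclideanSpace ℝ (Fin n)}
    (hy : y ∈ e.target) (u v w : EuclideanSpace ℝ (Fin n)) :
    S.gLoc e y (S.KLocL e y u v) w = S.aLoc e y u v w := by
  rw [KLocL_apply, ((S.isMetricOn_gLoc he).isInvertible hy).self_apply_inverse]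

lemma contDiffOn_KLocL (he : e ∈ atlas (EuclideanSpace ℝ (Fin n)) M) :
    ContDiffOn ℝ ∞ (S.KLocL e) e.target :=
  contDiffOn_clm_apply.2 fun _ => contDiffOn_clm_apply.2 fun _ =>
    (S.isMetricOn_gLoc he).contDiffOn_inverse.clm_apply
      (((S.isCubicOn_aLoc he).contDiffOn.clm_apply contDiffOn_const).clm_apply contDiffOn_const)

/-- Transporting `K` to the chart agrees with raising an index of the transported cubic form, by
nondegeneracy of the metric. -/
lemma Γ_eq (he : e ∈ atlas (EuclideanSpace ℝ (Fin n)) M) {y : EuclideanSpace ℝ (Fin n)}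
    (hy : y ∈ e.target) (u v : EuclideanSpace ℝ (Fin n)) :
    S.Γ e y u v = (christoffelL (S.gLoc e) y + S.KLocL e y) u v := by
  have : S.KLoc e y u v = S.KLocL e y u v :=
    (S.isMetricOn_gLoc he).ext_of_inner hy fun w => by
      rw [S.gLoc_KLoc he hy, S.gLoc_KLocL he hy]
  rw [Γ, ΓHat_eq, this]; rfl

lemma curvature_ΓHat (he : e ∈ atlas (EuclideanSpace ℝ (Fin n)) M)
    {y : EuclideanSpace ℝ (Fin n)} (hy : y ∈ e.target) (u v w : EuclideanSpace ℝ (Fin n)) :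
    curvature (S.ΓHat e) y u v w = curv (christoffelL (S.gLoc e)) y u v w := by
  rw [ΓHat_eq]
  exact curvature_eq_curv
    ((isLeviCivitaOn_christoffelL (S.isMetricOn_gLoc he)).differentiableAt_conn hy) u v w

lemma curvature_Γ (he : e ∈ atlas (EuclideanSpace ℝ (Fin n)) M)
    {y : EuclideanSpace ℝ (Fin n)} (hy : y ∈ e.target) (u v w : EuclideanSpace ℝ (Fin n)) :
    curvature (S.Γ e) y u v w =
      curv (fun y => christoffelL (S.gLoc e) y + S.KLocL e y) y u v w := by
  have hn := e.open_target.mem_nhds hy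
  have hd : DifferentiableAt ℝ (fun y => christoffelL (S.gLoc e) y + S.KLocL e y) y :=
    ((isLeviCivitaOn_christoffelL (S.isMetricOn_gLoc he)).differentiableAt_conn hy).add
      (((S.contDiffOn_KLocL he).contDiffAt hn).differentiableAt (by simp))
  rw [← curvature_eq_curv hd]
  have hev : ∀ a b, (fun z => S.Γ e z a b) =ᶠ[𝓝 y]
      fun z => (christoffelL (S.gLoc e) z + S.KLocL e z) a b := fun a b => by
    filter_upwards [hn] with z hz using S.Γ_eq he hz a b
  simp only [curvature, (hev _ _).fderiv_eq, S.Γ_eq he hy]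

/-- An orthonormal frame exists at each point of the manifold. -/
lemma exists_isOrthoFrame (x : M) :
    ∃ F : Fin (Module.finrank ℝ (EuclideanSpace ℝ (Fin n))) → EuclideanSpace ℝ (Fin n),
      IsOrthoFrame (S.metricAt x) F := by
  have h : IsMetricOn (fun _ : EuclideanSpace ℝ (Fin n) => S.metricAt x) Set.univ :=
    ⟨isOpen_univ, contDiffOn_const, fun _ _ => S.metricAt_symm x, fun _ _ => S.metricAt_pos x⟩
  obtain ⟨V, -, hy, F, hF⟩ := exists_isFrameOn h (Set.mem_univ 0)
  exact ⟨_, hF.orthoFrame 0 hy⟩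

/-- The squared norm of the cubic form. -/
noncomputable def cubicNormSq (x : M) : ℝ :=
  pairing (S.cubicAt x) (S.cubicAt x) (S.exists_isOrthoFrame x).choose

lemma isOrthoFrame_chartMap {y : EuclideanSpace ℝ (Fin n)}
    {F : Fin (Module.finrank ℝ (EuclideanSpace ℝ (Fin n))) → EuclideanSpace ℝ (Fin n)}
    (hF : IsOrthoFrame (S.gLoc e y) F) :
    IsOrthoFrame (S.metricAt (e.symm y)) fun i => chartMap e y (F i) :=
  isOrthoFrame_of_orth (S.metricAt_symm _) (S.metricAt_pos _) hF.orth (by simp)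

/-- The chart carries orthonormal frames to orthonormal frames, and `pairing_eq` makes the frame
chosen in `cubicNormSq` irrelevant. -/
lemma cubicNormSq_symm {y : EuclideanSpace ℝ (Fin n)}
    {F : Fin (Module.finrank ℝ (EuclideanSpace ℝ (Fin n))) → EuclideanSpace ℝ (Fin n)}
    (hF : IsOrthoFrame (S.gLoc e y) F) :
    S.cubicNormSq (e.symm y) = pairing (S.aLoc e y) (S.aLoc e y) F := by
  rw [cubicNormSq, ← pairing_eq (S.exists_isOrthoFrame (e.symm y)).choose_spec
    (S.isOrthoFrame_chartMap hF)]
  simp only [pairing, aLoc_apply]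

lemma inChart_τ (he : e ∈ atlas (EuclideanSpace ℝ (Fin n)) M) {y : EuclideanSpace ℝ (Fin n)}
    (hy : y ∈ e.target)
    {F : Fin (Module.finrank ℝ (EuclideanSpace ℝ (Fin n))) → EuclideanSpace ℝ (Fin n)}
    (hF : IsOrthoFrame (S.gLoc e y) F) (v : Fin 1 → EuclideanSpace ℝ (Fin n)) :
    inChart e S.τ y v = ∑ i, S.aLoc e y (F i) (F i) (v 0) := by
  have h := (S.isOrthoFrame_chartMap hF).trace_eq_sum
    (S.K (e.symm y) (chartMap e y (v 0)) : EuclideanSpace ℝ (Fin n) →L[ℝ] _).toLinearMap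
  refine h.trans (Finset.sum_congr rfl fun i _ => ?_)
  refine (S.metricAt_K _ _ _ _).trans ?_
  rw [← aLoc_apply, (S.isCubicOn_aLoc he).swap_left y hy, (S.isCubicOn_aLoc he).swap_right y hy]

end StatisticalStructure

end Charts

/-! ### The main theorem -/

section Main

set_option synthInstance.maxHeartbeats 200000

open Filter Topology

namespace StatisticalStructure

variable {n : ℕ} {M : Type*} [TopologicalSpace M] [ChartedSpace (EuclideanSpace ℝ (Fin n)) M]
  [IsManifold (𝓡 n) ∞ M] (S : StatisticalStructure n M)
  {e : OpenPartialHomeomorph M (EuclideanSpace ℝ (Fin n))}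

lemma isBochnerDatum (hconj : S.IsConjugateSymmetric) (hsec : S.SecHatNonneg)
    (hτ : S.NablaHatSqTauVanishes) (he : e ∈ atlas (EuclideanSpace ℝ (Fin n)) M) :
    IsBochnerDatum (S.gLoc e) (christoffelL (S.gLoc e)) (S.aLoc e)
      (fun y => S.cubicNormSq (e.symm y)) e.target where
  lc := isLeviCivitaOn_christoffelL (S.isMetricOn_gLoc he)
  cubic := S.isCubicOn_aLoc he
  nabla_swap y hy := by
    refine (S.isCubicOn_aLoc he).nabla_swap (isLeviCivitaOn_christoffelL (S.isMetricOn_gLoc he))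
      (S.contDiffOn_KLocL he) (fun y hy => S.gLoc_KLocL he hy) hy fun u v w z => ?_
    have := hconj e he y hy u v w z
    rwa [S.curvature_Γ he hy, S.curvature_Γ he hy] at this
  trace y hy F hF X Y w := by
    -- The trace can be differentiated only in a smooth frame field; the result at `y` is then
    -- transferred to the given frame.
    obtain ⟨V, hVU, hyV, F', hF'⟩ := exists_isFrameOn (S.isMetricOn_gLoc he) hy
    have h := hτ e he y hy ![X, Y, w]
    rw [ΓHat_eq, hF'.covDeriv_covDeriv_trace
      (isLeviCivitaOn_christoffelL (S.isMetricOn_gLoc he)) hVU hyV (S.isCubicOn_aLoc he)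
      fun z hz => S.inChart_τ he (hVU hz) (hF'.orthoFrame z hz)] at h
    have hB := (hF'.orthoFrame y hyV).trace_eq hF
      (ContinuousLinearMap.compL ℝ (EuclideanSpace ℝ (Fin n))
        (EuclideanSpace ℝ (Fin n) →L[ℝ] ℝ) ℝ (ContinuousLinearMap.apply ℝ ℝ w) ∘L
        nablaSq (christoffelL (S.gLoc e)) (S.aLoc e) y X Y)
    exact hB.trans h
  sec y hy u v hu hv huv := by
    have := hsec e he y hy u v ⟨hu, hv, huv⟩
    rwa [secHat, S.curvature_ΓHat he hy] at this
  normSq y _ _ hF := S.cubicNormSq_symm hF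

variable {S}

/-- A property of the norm of the cubic form that holds near a point in a chart holds near that
point in the manifold. -/
lemma eventually_cubicNormSq_chart {x : M} {P : ℝ → Prop} (hx : x ∈ e.source)
    (h : ∀ᶠ y in 𝓝 (e x), P (S.cubicNormSq (e.symm y))) : ∀ᶠ z in 𝓝 x, P (S.cubicNormSq z) := by
  filter_upwards [(e.continuousAt hx).eventually h, e.open_source.mem_nhds hx] with z hz hzs
  rwa [e.left_inv hzs] at hz

lemma continuous_cubicNormSq (H : ∀ e ∈ atlas (EuclideanSpace ℝ (Fin n)) M,
    IsBochnerDatum (S.gLoc e) (christoffelL (S.gLoc e)) (S.aLoc e)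
      (fun y => S.cubicNormSq (e.symm y)) e.target) : Continuous S.cubicNormSq := by
  refine continuous_iff_continuousAt.2 fun x => ?_
  set e := chartAt (EuclideanSpace ℝ (Fin n)) x
  have hx : x ∈ e.source := mem_chart_source _ x
  have h1 := ((H e (chart_mem_atlas _ x)).contDiffAt (e.map_source hx)).continuousAt
  have h2 := h1.comp (e.continuousAt hx)
  refine h2.congr ?_
  filter_upwards [e.open_source.mem_nhds hx] with z hz
  simp [e.left_inv hz]

/-- The norm of the cubic form is constant. -/
lemma cubicNormSq_const [CompactSpace M] [ConnectedSpace M]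
    (H : ∀ e ∈ atlas (EuclideanSpace ℝ (Fin n)) M,
    IsBochnerDatum (S.gLoc e) (christoffelL (S.gLoc e)) (S.aLoc e)
      (fun y => S.cubicNormSq (e.symm y)) e.target) (x x' : M) :
    S.cubicNormSq x = S.cubicNormSq x' := by
  have hc := continuous_cubicNormSq H
  obtain ⟨p, -, hp⟩ := isCompact_univ.exists_isMaxOn Set.univ_nonempty hc.continuousOn
  -- Closed by continuity; open because every point of this level set is again a maximum, to which
  -- the strong maximum principle applies.
  have hclopen : IsClopen {x | S.cubicNormSq x = S.cubicNormSq p} := by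
    refine ⟨isClosed_eq hc continuous_const, isOpen_iff_mem_nhds.2 fun x hx => ?_⟩
    have hxp : S.cubicNormSq x = S.cubicNormSq p := hx
    set e := chartAt (EuclideanSpace ℝ (Fin n)) x
    have hxs : x ∈ e.source := mem_chart_source _ x
    have h := (H e (chart_mem_atlas _ x)).eventually_eq_of_isLocalMax (e.map_source hxs) (by
      refine Eventually.of_forall fun y => ?_
      rw [e.left_inv hxs, hxp]
      exact hp (Set.mem_univ (e.symm y)))
    rw [e.left_inv hxs, hxp] at h
    exact eventually_cubicNormSq_chart (P := fun t => t = S.cubicNormSq p) hxs h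
  have huniv := hclopen.eq_univ ⟨p, rfl⟩
  have hall : ∀ x, S.cubicNormSq x = S.cubicNormSq p := fun x => by
    have : x ∈ {x | S.cubicNormSq x = S.cubicNormSq p} := by rw [huniv]; trivial
    exact this
  rw [hall, hall x']

end StatisticalStructure

end Main

end Statistical

theorem theorem6p2 {n : ℕ} {M : Type*} [TopologicalSpace M] [T2Space M] [CompactSpace M]
    [ConnectedSpace M] [ChartedSpace (EuclideanSpace ℝ (Fin n)) M] [IsManifold (𝓡 n) ∞ M]
    (S : Statistical.StatisticalStructure n M)
    (hconj : S.IsConjugateSymmetric)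
    (hsec : S.SecHatNonneg)
    (hτ : S.NablaHatSqTauVanishes) :
    S.NablaHatAVanishes ∧ (2 ≤ n → (∃ p : M, S.SecHatPosAt p) → S.IsTrivial) := by
  have H := fun e (he : e ∈ atlas (EuclideanSpace ℝ (Fin n)) M) =>
    S.isBochnerDatum hconj hsec hτ he
  have hconst := Statistical.StatisticalStructure.cubicNormSq_const H
  refine ⟨fun e he y hy v => ?_, fun hn => ?_⟩
  · have h := (H e he).nabla_eq_zero hy (Filter.Eventually.of_forall fun z => hconst _ _)
      (v 0) (v 1) (v 2) (v 3)
    rw [← Statistical.covDeriv_trilin _ ((H e he).cubic.differentiableAt hy),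
      ← Statistical.StatisticalStructure.ΓHat_eq] at h
    have hA : Statistical.inChart e S.A = fun y v => S.aLoc e y (v 0) (v 1) (v 2) := by
      funext y v; exact S.inChart_A e y v
    rw [hA]
    exact h
  · rintro ⟨p, hp⟩
    set e := chartAt (EuclideanSpace ℝ (Fin n)) p
    have he : e ∈ atlas (EuclideanSpace ℝ (Fin n)) M := chart_mem_atlas _ p
    have hps : p ∈ e.source := mem_chart_source _ p
    have hpt := e.map_source hps
    have hp0 : ∀ u v w, S.aLoc e (e p) u v w = 0 :=
      (H e he).eq_zero_of_sec_pos hpt (Filter.Eventually.of_forall fun z => hconst _ _)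
        (by simpa using hn) fun u v hu hv huv => by
          have := hp e he hps u v ⟨hu, hv, huv⟩
          rwa [Statistical.StatisticalStructure.secHat, S.curvature_ΓHat he hpt] at this
    obtain ⟨V, hVU, hyV, F, hF⟩ := Statistical.exists_isFrameOn (S.isMetricOn_gLoc he) hpt
    have hzero : S.cubicNormSq (e.symm (e p)) = 0 := by
      rw [S.cubicNormSq_symm (hF.orthoFrame _ hyV)]
      simp [Statistical.pairing, hp0]
    intro x u v
    have hx : S.cubicNormSq x = 0 := (hconst _ _).trans hzero
    have hcub : ∀ u v w, S.cubicAt x u v w = 0 :=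
      Statistical.eq_zero_of_pairing_self_eq_zero (S.exists_isOrthoFrame x).choose_spec hx
    -- With `A = 0` at `x`, the vector `K x u v` has squared length `A(u, v, K x u v) = 0`.
    by_contra hne
    have h1 := S.metricAt_pos x (S.K x u v) hne
    have h2 := S.metricAt_K x u v (S.K x u v)
    exact h1.ne' (h2.trans (hcub _ _ _))
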